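/- Let $f:\mathbb R^d\to\mathbb R$ be twice continuously differentiable with Hessian $H(x)=\nabla^2 f(x)$ satisfying $\lambda_{\min}I\preceq H(x)\preceq\lambda_{\max}I$ for all $x$, where $0<\lambda_{\min}\le\lambda_{\max}$. Let $\kappa=\lambda_{\max}/\lambda_{\min}$, let $x^\star$ be the minimizer of $f$, $H^\star=H(x^\star)$ and $\|v\|_{H^\star}=\sqrt{v^\top H^\star v}$. Assume $\|H(x)-H(y)\|\le L\|x-y\|$ for all $x,y$, with $L>0$ ($\|\cdot\|$ is the Euclidean norm of vectors and the spectral norm of matrices). For every $x$ let a stochastic oracle return $\hat H(x)=H(x)+E(x)$, where $E(x)$ is a random symmetric matrix, with law depending measurably on $x$, such that $\mathbb E\,E(x)=0$ and $\mathbb E\|E(x)\|^p\le p!\,\Upsilon_E^p/2$ for $p=2,3,\dots$, with $\Upsilon_E>0$. Put $\Upsilon=\Upsilon_E/\lambda_{\min}$. Let $\beta\in(0,1/2)$, $\rho\in(0,1)$. Consider the stochastic Newton method with uniform Hessian averaging started at a deterministic $x_0$: at step $t=0,1,2,\dots$ the oracle is queried at $x_t$, giving $\hat H_t=H(x_t)+E_t$,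 where, conditionally on the past (all previous iterates and noises, and $x_t$), $E_t$ has the law of $E(x_t)$; then $\tilde H_t=\frac{w_{t-1}}{w_t}\tilde H_{t-1}+\bigl(1-\frac{w_{t-1}}{w_t}\bigr)\hat H_t$ with $w_t=t+1$ and $\tilde H_{-1}=0$. If $\tilde H_tp=-\nabla f(x_t)$ has no solution $p$ with $\nabla f(x_t)^\top p<0$, then $x_{t+1}=x_t$. Otherwise $x_{t+1}=x_t+\mu_tp_t$ for such a solution $p_t$, with $\mu_t=\rho^{j_t}$ and $j_t\ge0$ the smallest integer such that $f(x_t+\mu_tp_t)\le f(x_t)+\mu_t\beta\nabla f(x_t)^\top p_t$. Let $\delta\in(0,1)$ with $d/\delta\ge e$, and let $\epsilon,\nu\in(0,1)$ satisfy $\max(\epsilon,\nu)\le\min\bigl(\tfrac13\cdot\tfrac{0.5-\beta}{1.5-\beta},\tfrac1{48}\bigr)$. Define $$\mathcal N_\nu=\{x:\|x-x^\star\|_{H^\star}\le\nu\lambda_{\min}^{3/2}/L\},\qquad \phi=\frac{4\rho\beta(1-\beta)(1-\epsilon)}{\kappa^2(1+\epsilon)},$$ $$\mathcal T_1=4\bigl(1\vee\tfrac{8\Upsilon}{\epsilon}\bigr)^2\log\Bigl(\frac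 d\delta\bigl(1\vee\tfrac{8\Upsilon}{\epsilon}\bigr)\Bigr),\qquad \mathcal T_2=\Bigl[\frac{1}{\phi}\log\Bigl(\frac{3L^2(f(x_0)-f(x^\star))}{\nu^2\lambda_{\min}^3}\Bigr)\Bigr]_+$$ (where $[a]_+=\max(a,0)$, and $\mathcal T_2=0$ if $x_0=x^\star$), $\mathcal T=\mathcal T_1+\mathcal T_2$, $\mathcal J=4\mathcal T\kappa/\nu$ and $$\mathcal K=\frac{\mathcal T^2\kappa^2}{4\Upsilon^2\log(d\mathcal T/\delta)}-\mathcal T-\mathcal J .$$ Then, with probability at least $1-\delta\pi^2/6$, all of the following hold (for integers $t\ge0$; the transition times are real numbers): (a), (b) $x_t\in\mathcal N_\nu$ for all $t\ge\mathcal T$; in particular the iteration reaches $\mathcal N_\nu$ from $x_0$ by time $\mathcal T$ and stays in it for $\mathcal T\le t\le\mathcal T+\mathcal J$. Moreover, from $\mathcal T_1$ on the convergence is $R$-linear: for all $t\ge\mathcal T_1$, $\|x_t-x^\star\|\le\bigl\{\frac{2}{\lambda_{\min}}(f(x_0)-f(x^\star))(1-\phi)^{t-\mathcal T_1}\bigr\}^{1/2}$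 and $\|x_t-x^\star\|_{H^\star}\le\bigl\{2\kappa(f(x_0)-f(x^\star))(1-\phi)^{t-\mathcal T_1}\bigr\}^{1/2}$. (c) For $0\le t-\mathcal T-\mathcal J\le\mathcal K$: $\|x_{t+1}-x^\star\|_{H^\star}\le12\,\rho^{(1)}_t\,\|x_t-x^\star\|_{H^\star}$ with $\rho^{(1)}_t=\dfrac{8\mathcal T\kappa}{t+1}$. (d) For $t\ge\mathcal T+\mathcal J+\mathcal K$: $\|x_{t+1}-x^\star\|_{H^\star}\le12\,\rho^{(2)}_t\,\|x_t-x^\star\|_{H^\star}$ with $\rho^{(2)}_t=16\Upsilon\sqrt{\dfrac{\log(d(t+1)/\delta)}{t+1}}$. -/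

import Mathlib

namespace HessianAveraging

open MeasureTheory ProbabilityTheory

/-- The space `ℝ^d` with its Euclidean norm. -/
abbrev Vec (d : ℕ) : Type := EuclideanSpace ℝ (Fin d)

/-- Real `d × d` matrices, seen as linear operators of `ℝ^d`; the norm is the spectral norm, the
σ-algebra is the Borel one, and the transpose is the adjoint. -/
abbrev Mat (d : ℕ) : Type := Vec d →L[ℝ] Vec d

/-- The Hessian matrix of `f` at `x`, the derivative of the gradient. -/
noncomputable def hess {d : ℕ} (f : Vec d → ℝ) (x : Vec d) : Mat d :=
  fderiv ℝ (gradient f) x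

/-- The weighted norm `√(vᵀ A v)`. -/
noncomputable def wnorm {d : ℕ} (A : Mat d) (v : Vec d) : ℝ :=
  Real.sqrt (inner ℝ v (A v))

/-- The objective: `f` is twice continuously differentiable and
`lmin • I ≼ ∇²f(x) ≼ lmax • I` for all `x`, with `0 < lmin ≤ lmax`. -/
structure IsObjective {d : ℕ} (f : Vec d → ℝ) (lmin lmax : ℝ) : Prop where
  smooth : ContDiff ℝ 2 f
  pos : 0 < lmin
  le : lmin ≤ lmax
  lower : ∀ x v : Vec d, lmin * ‖v‖ ^ 2 ≤ inner ℝ v (hess f x v)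
  upper : ∀ x v : Vec d, inner ℝ v (hess f x v) ≤ lmax * ‖v‖ ^ 2

/-- The stochastic Hessian oracle: `noise x` is the law of the random noise matrix `E(x)`.
It is symmetric, has mean zero, and `‖E(x)‖` is `UE`-sub-exponential, that is
`𝔼 ‖E(x)‖ ^ p ≤ p! * UE ^ p / 2` for `p = 2, 3, …`. -/
structure IsSubexpNoise {d : ℕ} (noise : Kernel (Vec d) (Mat d)) (UE : ℝ) : Prop where
  markov : IsMarkovKernel noise
  symm : ∀ x, ∀ᵐ A ∂(noise x), IsSelfAdjoint A
  mean_zero : ∀ x, ∫ A, A ∂(noise x) = 0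
  subexp : ∀ x, ∀ p : ℕ, 2 ≤ p →
    ∫⁻ A, ‖A‖ₑ ^ p ∂(noise x) ≤ ENNReal.ofReal (p.factorial * UE ^ p / 2)

/-- Online Hessian averaging. The weights `w₋₁ = 0, w₀, w₁, …` are stored with the index shifted by
one, `W n = wₙ₋₁`, and so is the result: `avgHessian W Hhat n` is the average called `H̃ₙ₋₁`, with
`H̃₋₁ = 0` and `H̃ₜ = (wₜ₋₁ / wₜ) H̃ₜ₋₁ + (1 - wₜ₋₁ / wₜ) Ĥₜ`. -/
noncomputable def avgHessian {d : ℕ} (W : ℕ → ℝ) (Hhat : ℕ → Mat d) : ℕ → Mat d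
  | 0 => 0
  | n + 1 => (W n / W (n + 1)) • avgHessian W Hhat n + (1 - W n / W (n + 1)) • Hhat n

/-- One step `x ↦ x'` of the algorithm with the averaged Hessian `A`: a solution `p` of
`A p = -∇f(x)` with `∇f(x)ᵀ p < 0` is used with the step size `ρ ^ j`, `j` the smallest natural
number for which the Armijo condition holds; if there is none, the iterate is kept. (For symmetric
`A` the number `∇f(x)ᵀ p` is the same for all solutions `p`.) -/
def NewtonStep {d : ℕ} (f : Vec d → ℝ) (β ρ : ℝ) (A : Mat d) (x x' : Vec d) : Prop :=
  (∃ p : Vec d, A p = -gradient f x ∧ inner ℝ (gradient f x) p < 0 ∧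
    ∃ j : ℕ,
      IsLeast {i : ℕ | f (x + ρ ^ i • p) ≤ f x + ρ ^ i * β * inner ℝ (gradient f x) p} j ∧
      x' = x + ρ ^ j • p) ∨
  ((∀ p : Vec d, A p = -gradient f x → 0 ≤ inner ℝ (gradient f x) p) ∧ x' = x)

/-- `x` and `E` are the iterates and the noise matrices of a run of the algorithm from `x₀`, on the
probability space `(Ω, P)`, with the history up to the iterate `x t` contained in `𝓕 t`. At time `t`
the oracle is queried at `x t`: given the past `𝓕 t`, the noise `E t` has the law `noise (x t)`. -/
structure IsRun {d : ℕ} {Ω : Type*} {mΩ : MeasurableSpace Ω} (P : Measure Ω)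
    (f : Vec d → ℝ) (noise : Kernel (Vec d) (Mat d)) (W : ℕ → ℝ) (β ρ : ℝ) (x₀ : Vec d)
    (𝓕 : Filtration ℕ mΩ) (x : ℕ → Ω → Vec d) (E : ℕ → Ω → Mat d) : Prop where
  init : ∀ ω, x 0 ω = x₀
  measurable_iterate : ∀ t, Measurable[𝓕 t] (x t)
  measurable_noise : ∀ t, Measurable[𝓕 (t + 1)] (E t)
  oracle : ∀ t, ∀ S : Set Ω, MeasurableSet[𝓕 t] S → ∀ B : Set (Mat d), MeasurableSet B →
    P (S ∩ E t ⁻¹' B) = ∫⁻ ω in S, noise (x t ω) B ∂P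
  step : ∀ᵐ ω ∂P, ∀ t, NewtonStep f β ρ
    (avgHessian W (fun i => hess f (x i ω) + E i ω) (t + 1)) (x t ω) (x (t + 1) ω)

/-- The weights of uniform averaging, `wₜ = t + 1`, in the shifted indexing `W n = wₙ₋₁`. -/
def uniformWeights (n : ℕ) : ℝ := n

/-- The neighbourhood `N_ν` of `xs`, with `Hs` the Hessian at `xs`. -/
def nbhd {d : ℕ} (Hs : Mat d) (xs : Vec d) (lmin L ν : ℝ) : Set (Vec d) :=
  {x | wnorm Hs (x - xs) ≤ ν * lmin ^ (3 / 2 : ℝ) / L}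

/-- The linear rate `φ`. -/
noncomputable def linRate (κ β ρ ε : ℝ) : ℝ :=
  4 * ρ * β * (1 - β) * (1 - ε) / (κ ^ 2 * (1 + ε))

/-- The iteration count `𝒯₁`. -/
noncomputable def timeOne (d : ℕ) (Υ ε δ : ℝ) : ℝ :=
  4 * (max 1 (8 * Υ / ε)) ^ 2 * Real.log (d / δ * max 1 (8 * Υ / ε))

/-- The iteration count `𝒯₂`, with `gap = f(x₀) - f(xs)`. The positive part concerns only initial
points with `3 L² gap < ν² lmin³`, where the formula inside would not be a count. -/
noncomputable def timeTwo (κ β ρ ε ν L lmin gap : ℝ) : ℝ :=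
  max 0 (κ ^ 2 * (1 + ε) / (4 * ρ * β * (1 - β) * (1 - ε)) *
    Real.log (3 * L ^ 2 * gap / (ν ^ 2 * lmin ^ 3)))

/-- The superlinear rate `8 𝒯 κ / (t + 1)`. -/
noncomputable def rateOne (T κ : ℝ) (t : ℕ) : ℝ := 8 * T * κ / (t + 1)

/-- The superlinear rate `16 Υ √(log (d (t + 1) / δ) / (t + 1))`. -/
noncomputable def rateTwo (d : ℕ) (Υ δ : ℝ) (t : ℕ) : ℝ :=
  16 * Υ * Real.sqrt (Real.log (d * (t + 1) / δ) / (t + 1))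

end HessianAveraging

/-!
Stochastic Newton with uniform Hessian averaging: why the convergence phases hold with high
probability.

The averaged Hessian is the mean of the true Hessians at the iterates plus the averaged noise. The
noise part is a matrix martingale, and `trExp`, the trace exponential, turns its spectral norm into
a scalar supermartingale. One step of it rests on `exists_trExp_add_le`, a second order bound of
`tr exp (A + X)` that follows from a scalar inequality summed over the eigenbases of `A` and
`A + X`; the sub-exponential moments then control the remainder (`lintegral_trExp_add_le`), and
Ville's inequality (`IsRun.ville`) gives tails of the running maximum. Two bounds are drawn from it.
A union bound over the times `n` gives `8 UE √(log (d n / δ) / n)` for the averaged noise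
(`IsRun.measure_noiseSum_ge_le`). On the first superlinear phase this is not enough when `UE` is
small, since the end `N` of that phase may then exceed every power of `T`; there the sums are
bounded by `40 T κ lmin` uniformly in `n ≤ N + 1` (`IsRun.measure_exists_noiseSum_ge_le`). As
`T₁ ≥ 4`, the term `n = 1` of `∑ δ / n² = δ π² / 6` is free to pay for this second event.

The rest is deterministic. From `T₁` on the averaged noise is at most `ε lmin`, so that the averaged
Hessian has spectrum in `[(1 - ε) lmin, (1 + ε) lmax]` and every damped step decreases the objective
gap by the factor `1 - φ` (`NewtonStep.gap_le`); after `timeTwo` further steps the iterates stay in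
the neighbourhood. There the unit step is accepted as soon as `T κ / (t + 1)` is small compared with
`max ε ν`, and the weighted distance shrinks by the relative error of the averaged Hessian plus the
current relative distance (`NewtonStep.local_contraction`). Iterates before `T` contribute at most
`κ` each to that error; those between `T` and `T + J` contribute at most `ν` each, together
`J ν = 4 T κ`; later ones decay geometrically (`IsLocalPhase.lateSum_le`). Hence the contraction
factor is of order `T κ / (t + 1)` plus the averaged noise (`IsLocalPhase.superlinear`), and the two
superlinear phases are the times at which the first or the second summand dominates.
-/

namespace HessianAveraging

open MeasureTheory ProbabilityTheory

/-! ### The trace exponential of symmetric matrices -/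

/-- The trace exponential `tr exp A`. -/
noncomputable def trExp {d : ℕ} (A : Mat d) : ℝ :=
  LinearMap.trace ℝ (Vec d) (NormedSpace.exp A : Mat d)

lemma isSelfAdjoint_add {d : ℕ} {A B : Mat d} (hA : IsSelfAdjoint A) (hB : IsSelfAdjoint B) :
    IsSelfAdjoint (A + B) := by
  rw [ContinuousLinearMap.isSelfAdjoint_iff'] at *
  rw [map_add, hA, hB]

lemma isSelfAdjoint_smul {d : ℕ} {A : Mat d} (hA : IsSelfAdjoint A) (c : ℝ) :
    IsSelfAdjoint (c • A) := by
  rw [ContinuousLinearMap.isSelfAdjoint_iff'] at *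
  rw [map_smulₛₗ, hA]
  simp

lemma continuous_trExp {d : ℕ} : Continuous (trExp : Mat d → ℝ) := by
  have h : Continuous fun B : Mat d => LinearMap.trace ℝ (Vec d) (B : Vec d →ₗ[ℝ] Vec d) := by
    have := LinearMap.continuous_of_finiteDimensional
      ((LinearMap.trace ℝ (Vec d)).comp (ContinuousLinearMap.coeLM ℝ : Mat d →ₗ[ℝ] _))
    exact this
  let _ : NormedAlgebra ℚ (Mat d) := NormedAlgebra.restrictScalars ℚ ℝ (Mat d)
  exact h.comp NormedSpace.exp_continuous

lemma exists_eigenbasis {d : ℕ} {A : Mat d} (hA : IsSelfAdjoint A) :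
    ∃ (b : OrthonormalBasis (Fin d) ℝ (Vec d)) (l : Fin d → ℝ), ∀ i, A (b i) = l i • b i := by
  have hs := (ContinuousLinearMap.isSelfAdjoint_iff_isSymmetric.1 hA)
  have hd : Module.finrank ℝ (Vec d) = d := by simp
  refine ⟨hs.eigenvectorBasis hd, hs.eigenvalues hd, fun i => ?_⟩
  exact hs.apply_eigenvectorBasis hd i

lemma exp_apply_of_eigenvector {d : ℕ} {A : Mat d} {l : ℝ} {v : Vec d} (h : A v = l • v) :
    (NormedSpace.exp A : Mat d) v = Real.exp l • v := by
  have hpow : ∀ n : ℕ, (A ^ n) v = l ^ n • v := by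
    intro n
    induction n with
    | zero => simp
    | succ n ih => rw [pow_succ, mul_apply_eq_comp, h, map_smul, ih, smul_smul]; ring_nf
  have h1 := NormedSpace.exp_series_hasSum_exp' (𝕂 := ℝ) A
  have h2 := h1.mapL (ContinuousLinearMap.apply ℝ (Vec d) v)
  have h3 := (NormedSpace.exp_series_hasSum_exp' (𝕂 := ℝ) l).smul_const v
  refine (h2.unique ?_).trans (by rw [Real.exp_eq_exp_ℝ])
  convert! h3 using 2 with n
  simp [hpow, smul_smul]

lemma trExp_eq_sum {d : ℕ} {A : Mat d} {b : OrthonormalBasis (Fin d) ℝ (Vec d)} {l : Fin d → ℝ}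
    (h : ∀ i, A (b i) = l i • b i) : trExp A = ∑ i, Real.exp (l i) := by
  rw [trExp, LinearMap.trace_eq_sum_inner _ b]
  refine Finset.sum_congr rfl fun i _ => ?_
  simp [exp_apply_of_eigenvector (h i), inner_smul_right]

lemma trExp_nonneg {d : ℕ} {A : Mat d} (hA : IsSelfAdjoint A) : 0 ≤ trExp A := by
  obtain ⟨b, l, h⟩ := exists_eigenbasis hA
  rw [trExp_eq_sum h]
  positivity

lemma trExp_zero {d : ℕ} : trExp (0 : Mat d) = d := by
  rw [trExp_eq_sum (b := EuclideanSpace.basisFun (Fin d) ℝ) (l := fun _ => 0) (by simp)]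
  simp

/-- The spectral norm of a symmetric matrix is at most the largest modulus of an eigenvalue. -/
lemma norm_le_of_abs_eigenvalue_le {d : ℕ} {A : Mat d}
    {b : OrthonormalBasis (Fin d) ℝ (Vec d)} {l : Fin d → ℝ}
    (h : ∀ i, A (b i) = l i • b i) {c : ℝ} (hc : 0 ≤ c) (hl : ∀ i, |l i| ≤ c) : ‖A‖ ≤ c := by
  refine ContinuousLinearMap.opNorm_le_bound _ hc fun v => ?_
  have hsq : ‖A v‖ ^ 2 ≤ (c * ‖v‖) ^ 2 := by
    have hv : A v = ∑ i, (inner ℝ (b i) v * l i) • b i := by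
      conv_lhs => rw [← b.sum_repr' v]
      simp [map_sum, h, smul_smul]
    have h1 : ∀ i, inner ℝ (b i) (A v) = inner ℝ (b i) v * l i := by
      intro i
      rw [hv, b.orthonormal.inner_right_fintype]
    rw [← b.sum_sq_inner_right (A v), mul_pow, ← b.sum_sq_inner_right v, Finset.mul_sum]
    refine Finset.sum_le_sum fun i _ => ?_
    rw [h1, mul_pow, mul_comm]
    exact mul_le_mul_of_nonneg_right (sq_le_sq.2 ((hl i).trans (le_abs_self c))) (sq_nonneg _)
  exact le_of_sq_le_sq hsq (by positivity)

/-- A symmetric matrix is bounded in norm by its quadratic form. -/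
lemma norm_le_of_quadForm {d : ℕ} {A : Mat d} (hA : IsSelfAdjoint A) {c : ℝ} (hc : 0 ≤ c)
    (h : ∀ v : Vec d, |inner ℝ v (A v)| ≤ c * ‖v‖ ^ 2) : ‖A‖ ≤ c := by
  obtain ⟨b, l, hb⟩ := exists_eigenbasis hA
  refine norm_le_of_abs_eigenvalue_le hb hc fun i => ?_
  have := h (b i)
  simpa [hb, inner_smul_right] using this

/-- An eigenvalue of largest modulus is seen by the trace exponential of `A` or of `-A`, according to
its sign. -/
lemma exp_norm_le_trExp_or {d : ℕ} (hd : 0 < d) {A : Mat d} (hA : IsSelfAdjoint A) :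
    Real.exp ‖A‖ ≤ trExp A ∨ Real.exp ‖A‖ ≤ trExp (-A) := by
  obtain ⟨b, l, h⟩ := exists_eigenbasis hA
  have : Nonempty (Fin d) := ⟨⟨0, hd⟩⟩
  obtain ⟨i, -, hi⟩ := Finset.exists_max_image Finset.univ (fun i => |l i|) Finset.univ_nonempty
  have h1 : ‖A‖ ≤ |l i| := norm_le_of_abs_eigenvalue_le h (abs_nonneg _)
    (fun j => hi j (Finset.mem_univ j))
  have h' : ∀ i, (-A) (b i) = (-l i) • b i := fun i => by simp [h]
  rw [trExp_eq_sum h, trExp_eq_sum h']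
  have h2 : Real.exp (l i) ≤ ∑ i, Real.exp (l i) :=
    Finset.single_le_sum (f := fun i => Real.exp (l i)) (fun i _ => (Real.exp_pos _).le)
      (Finset.mem_univ i)
  have h3 : Real.exp (-l i) ≤ ∑ i, Real.exp (-l i) :=
    Finset.single_le_sum (f := fun i => Real.exp (-l i)) (fun i _ => (Real.exp_pos _).le)
      (Finset.mem_univ i)
  rcases abs_cases (l i) with ⟨ha, _⟩ | ⟨ha, _⟩ <;> rw [ha] at h1
  · exact Or.inl ((Real.exp_le_exp.2 h1).trans h2)
  · exact Or.inr ((Real.exp_le_exp.2 h1).trans h3)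

/-- A second order bound of the exponential that is symmetric under exchange of the end points. -/
lemma exp_le_second_order (t : ℝ) :
    Real.exp t ≤ 1 + t + t ^ 2 / 2 * (1 + Real.exp t) := by
  rcases le_total 0 t with ht | ht
  · have hmono : MonotoneOn (fun s : ℝ => (1 + s) * Real.exp (-s) + s ^ 2 / 2) (Set.Ici 0) := by
      have hder : ∀ s : ℝ, HasDerivAt (fun s : ℝ => (1 + s) * Real.exp (-s) + s ^ 2 / 2)
          (s * (1 - Real.exp (-s))) s := by
        intro s
        have h1 := ((hasDerivAt_id s).const_add 1).mul ((hasDerivAt_id s).neg.exp)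
        have h2 := ((hasDerivAt_id s).pow 2).div_const 2
        convert! h1.add h2 using 1
        simp
        ring
      refine monotoneOn_of_deriv_nonneg (convex_Ici 0)
        (fun s _ => (hder s).continuousAt.continuousWithinAt)
        (fun s _ => (hder s).differentiableAt.differentiableWithinAt) fun s hs => ?_
      rw [interior_Ici] at hs
      have hs' : (0 : ℝ) < s := hs
      rw [(hder s).deriv]
      have : Real.exp (-s) ≤ 1 := Real.exp_le_one_iff.2 (by linarith)
      exact mul_nonneg hs'.le (by linarith)
    have h := hmono (Set.mem_Ici.2 le_rfl) (Set.mem_Ici.2 ht) ht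
    simp only [add_zero, neg_zero, Real.exp_zero, mul_one] at h
    have h1 := mul_le_mul_of_nonneg_right h (Real.exp_pos t).le
    have h2 : Real.exp (-t) * Real.exp t = 1 := by rw [← Real.exp_add]; simp
    have h3 : ((1 + t) * Real.exp (-t) + t ^ 2 / 2) * Real.exp t
        = (1 + t) + t ^ 2 / 2 * Real.exp t := by
      linear_combination (1 + t) * h2
    nlinarith [sq_nonneg t]
  · have h1 := Real.quadratic_le_exp_of_nonneg (x := -t) (by linarith)
    have h2 : Real.exp (-t) * Real.exp t = 1 := by rw [← Real.exp_add]; simp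
    have h3 : (1 + -t + (-t) ^ 2 / 2) * Real.exp t ≤ 1 := by
      exact (mul_le_mul_of_nonneg_right h1 (Real.exp_pos t).le).trans_eq h2
    have h4 : 0 < 1 + -t + (-t) ^ 2 / 2 := by nlinarith [sq_nonneg t]
    have h5 : Real.exp t ≤ 1 + t + t ^ 2 / 2 := by
      have : (1 + -t + (-t) ^ 2 / 2) * Real.exp t
          ≤ (1 + -t + (-t) ^ 2 / 2) * (1 + t + t ^ 2 / 2) := by
        refine h3.trans ?_
        nlinarith [sq_nonneg (t ^ 2)]
      exact le_of_mul_le_mul_left this h4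
    have h6 : 0 ≤ t ^ 2 / 2 * Real.exp t := by positivity
    linarith

lemma exp_le_exp_second_order (a b : ℝ) :
    Real.exp b ≤ Real.exp a + (b - a) * Real.exp a
      + (b - a) ^ 2 / 2 * (Real.exp a + Real.exp b) := by
  have h := mul_le_mul_of_nonneg_left (exp_le_second_order (b - a)) (Real.exp_pos a).le
  have h1 : Real.exp a * Real.exp (b - a) = Real.exp b := by rw [← Real.exp_add]; ring_nf
  have h2 : Real.exp a * (1 + (b - a) + (b - a) ^ 2 / 2 * (1 + Real.exp (b - a)))
      = Real.exp a + (b - a) * Real.exp a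
        + (b - a) ^ 2 / 2 * (Real.exp a + Real.exp a * Real.exp (b - a)) := by ring
  rw [h2, h1] at h
  exact h

section TwoBases

variable {d : ℕ} {A X : Mat d} {b c : OrthonormalBasis (Fin d) ℝ (Vec d)} {l m : Fin d → ℝ}

/-- In the eigenbases of `A` and `A + X` the perturbation `X` acts as a difference of eigenvalues. -/
lemma inner_perturbation_eigen (hA : IsSelfAdjoint A) (hb : ∀ i, A (b i) = l i • b i)
    (hc : ∀ j, (A + X) (c j) = m j • c j) (i j : Fin d) :
    inner ℝ (b i) (X (c j)) = (m j - l i) * inner ℝ (b i) (c j) := by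
  have hs : ∀ u v : Vec d, inner ℝ (A u) v = inner ℝ u (A v) := fun u v =>
    ContinuousLinearMap.isSelfAdjoint_iff_isSymmetric.1 hA u v
  have h1 : X (c j) = m j • c j - A (c j) := by rw [← hc j]; simp
  rw [h1, inner_sub_right, ← hs, hb, inner_smul_left, inner_smul_right]
  simp
  ring

/-- The trace exponential grows at most by the factor `exp ‖X‖` under a perturbation `X`. -/
lemma trExp_add_le_exp_norm (hA : IsSelfAdjoint A) (hX : IsSelfAdjoint X) :
    trExp (A + X) ≤ Real.exp ‖X‖ * trExp A := by
  obtain ⟨b, l, hb⟩ := exists_eigenbasis hA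
  have hAX : IsSelfAdjoint (A + X) := isSelfAdjoint_add hA hX
  obtain ⟨c, m, hc⟩ := exists_eigenbasis hAX
  rw [trExp_eq_sum hb, trExp_eq_sum hc, Finset.mul_sum]
  have hrow : ∀ i, ∑ j, inner ℝ (b i) (c j) ^ 2 = (1 : ℝ) := fun i => by
    rw [c.sum_sq_inner_left]; simp
  have hcol : ∀ j, ∑ i, inner ℝ (b i) (c j) ^ 2 = (1 : ℝ) := fun j => by
    rw [b.sum_sq_inner_right]; simp
  -- convexity of `exp`, summed against the doubly stochastic matrix `⟪b i, c j⟫ ^ 2`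
  have hscal : ∀ i j, inner ℝ (b i) (c j) ^ 2 * (Real.exp (m j) * (1 + ‖X‖))
        - Real.exp (m j) * (inner ℝ (b i) (c j) * inner ℝ (b i) (X (c j)))
      ≤ inner ℝ (b i) (c j) ^ 2 * (Real.exp ‖X‖ * Real.exp (l i)) := by
    intro i j
    rw [inner_perturbation_eigen hA hb hc]
    have h1 : Real.exp (m j) * (1 + ‖X‖ - (m j - l i)) ≤ Real.exp ‖X‖ * Real.exp (l i) := by
      have h2 := Real.add_one_le_exp (‖X‖ - (m j - l i))
      have h3 : Real.exp ‖X‖ * Real.exp (l i)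
          = Real.exp (m j) * Real.exp (‖X‖ - (m j - l i)) := by
        rw [← Real.exp_add, ← Real.exp_add]; ring_nf
      rw [h3]
      exact mul_le_mul_of_nonneg_left (by linarith) (Real.exp_pos _).le
    have := mul_le_mul_of_nonneg_left h1 (sq_nonneg (inner ℝ (b i) (c j)))
    refine le_trans (le_of_eq ?_) this
    ring
  have hsum := Finset.sum_le_sum fun i (_ : i ∈ Finset.univ) =>
    Finset.sum_le_sum fun j (_ : j ∈ Finset.univ) => hscal i j
  have hR : ∑ i, ∑ j, inner ℝ (b i) (c j) ^ 2 * (Real.exp ‖X‖ * Real.exp (l i))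
      = ∑ i, Real.exp ‖X‖ * Real.exp (l i) := by
    refine Finset.sum_congr rfl fun i _ => ?_
    rw [← Finset.sum_mul, hrow, one_mul]
  rw [hR] at hsum
  refine le_trans ?_ hsum
  rw [Finset.sum_comm]
  refine Finset.sum_le_sum fun j _ => ?_
  rw [Finset.sum_sub_distrib, ← Finset.sum_mul, hcol, ← Finset.mul_sum]
  have hin : ∑ i, inner ℝ (b i) (c j) * inner ℝ (b i) (X (c j)) = inner ℝ (c j) (X (c j)) := by
    rw [← b.sum_inner_mul_inner (c j) (X (c j))]
    exact Finset.sum_congr rfl fun i _ => by rw [real_inner_comm]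
  rw [hin]
  have h4 : inner ℝ (c j) (X (c j)) ≤ ‖X‖ := by
    refine (real_inner_le_norm _ _).trans ?_
    have := X.le_opNorm (c j)
    simpa using this
  nlinarith [Real.exp_pos (m j)]

/-- Second order expansion of the trace exponential: the linear term is `tr (X exp A)`, and the
remainder is controlled by `‖X‖` alone. The double sum over the eigenbases of `A` and `A + X`
replaces the Golden-Thompson inequality. -/
lemma exists_trExp_add_le (hA : IsSelfAdjoint A) : ∃ ℓ : Mat d →L[ℝ] ℝ, ∀ X : Mat d,
    IsSelfAdjoint X →
      trExp (A + X) ≤ trExp A + ℓ X + trExp A * (‖X‖ ^ 2 * Real.exp ‖X‖) := by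
  obtain ⟨b, l, hb⟩ := exists_eigenbasis hA
  refine ⟨∑ i, Real.exp (l i) •
    ((innerSL ℝ (b i)).comp (ContinuousLinearMap.apply ℝ (Vec d) (b i))), fun X hX => ?_⟩
  have hgrow := trExp_add_le_exp_norm hA hX
  have hAX : IsSelfAdjoint (A + X) := isSelfAdjoint_add hA hX
  obtain ⟨c, m, hc⟩ := exists_eigenbasis hAX
  have hs : ∀ u v : Vec d, inner ℝ (X u) v = inner ℝ u (X v) := fun u v =>
    ContinuousLinearMap.isSelfAdjoint_iff_isSymmetric.1 hX u v
  have hrow : ∀ i, ∑ j, inner ℝ (b i) (c j) ^ 2 = (1 : ℝ) := fun i => by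
    rw [c.sum_sq_inner_left]; simp
  have hcol : ∀ j, ∑ i, inner ℝ (b i) (c j) ^ 2 = (1 : ℝ) := fun j => by
    rw [b.sum_sq_inner_right]; simp
  have hnA := trExp_nonneg hA
  have hℓ : (∑ i, Real.exp (l i) •
      ((innerSL ℝ (b i)).comp (ContinuousLinearMap.apply ℝ (Vec d) (b i)))) X
      = ∑ i, Real.exp (l i) * inner ℝ (b i) (X (b i)) := by
    simp
  rw [hℓ]
  have hscal : ∀ i j, inner ℝ (b i) (c j) ^ 2 * Real.exp (m j)
      ≤ inner ℝ (b i) (c j) ^ 2 * Real.exp (l i)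
        + Real.exp (l i) * (inner ℝ (b i) (c j) * inner ℝ (b i) (X (c j)))
        + (Real.exp (l i) / 2 * inner ℝ (b i) (X (c j)) ^ 2
          + Real.exp (m j) / 2 * inner ℝ (b i) (X (c j)) ^ 2) := by
    intro i j
    rw [inner_perturbation_eigen hA hb hc]
    have := mul_le_mul_of_nonneg_left (exp_le_exp_second_order (l i) (m j))
      (sq_nonneg (inner ℝ (b i) (c j)))
    refine this.trans (le_of_eq ?_)
    ring
  have hsum := Finset.sum_le_sum fun i (_ : i ∈ Finset.univ) =>
    Finset.sum_le_sum fun j (_ : j ∈ Finset.univ) => hscal i j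
  simp only [Finset.sum_add_distrib] at hsum
  have h1 : ∑ i, ∑ j, inner ℝ (b i) (c j) ^ 2 * Real.exp (m j) = trExp (A + X) := by
    rw [trExp_eq_sum hc, Finset.sum_comm]
    refine Finset.sum_congr rfl fun j _ => ?_
    rw [← Finset.sum_mul, hcol, one_mul]
  have h2 : ∑ i, ∑ j, inner ℝ (b i) (c j) ^ 2 * Real.exp (l i) = trExp A := by
    rw [trExp_eq_sum hb]
    refine Finset.sum_congr rfl fun i _ => ?_
    rw [← Finset.sum_mul, hrow, one_mul]
  have h3 : ∑ i, ∑ j, Real.exp (l i) * (inner ℝ (b i) (c j) * inner ℝ (b i) (X (c j)))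
      = ∑ i, Real.exp (l i) * inner ℝ (b i) (X (b i)) := by
    refine Finset.sum_congr rfl fun i _ => ?_
    rw [← Finset.mul_sum]
    congr 1
    rw [← hs, ← c.sum_inner_mul_inner (X (b i)) (b i)]
    refine Finset.sum_congr rfl fun j _ => ?_
    rw [hs, mul_comm, real_inner_comm (c j) (b i)]
  have hXb : ∀ v : Vec d, ‖v‖ = 1 → ‖X v‖ ^ 2 ≤ ‖X‖ ^ 2 := fun v hv => by
    have := X.le_opNorm v
    rw [hv, mul_one] at this
    gcongr
  have h4 : ∑ i, ∑ j, Real.exp (l i) / 2 * inner ℝ (b i) (X (c j)) ^ 2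
      ≤ ‖X‖ ^ 2 / 2 * trExp A := by
    rw [trExp_eq_sum hb, Finset.mul_sum]
    refine Finset.sum_le_sum fun i _ => ?_
    rw [← Finset.mul_sum]
    have : ∑ j, inner ℝ (b i) (X (c j)) ^ 2 = ‖X (b i)‖ ^ 2 := by
      rw [← c.sum_sq_inner_left (X (b i))]
      simp only [hs]
    rw [this]
    nlinarith [Real.exp_pos (l i), hXb (b i) (by simp)]
  have h5 : ∑ i, ∑ j, Real.exp (m j) / 2 * inner ℝ (b i) (X (c j)) ^ 2
      ≤ ‖X‖ ^ 2 / 2 * trExp (A + X) := by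
    rw [trExp_eq_sum hc, Finset.mul_sum, Finset.sum_comm]
    refine Finset.sum_le_sum fun j _ => ?_
    rw [← Finset.mul_sum, b.sum_sq_inner_right]
    nlinarith [Real.exp_pos (m j), hXb (c j) (by simp)]
  rw [h1, h2, h3] at hsum
  have h6 : ‖X‖ ^ 2 / 2 * trExp (A + X) ≤ ‖X‖ ^ 2 / 2 * (Real.exp ‖X‖ * trExp A) := by gcongr
  have h7 : ‖X‖ ^ 2 / 2 * trExp A ≤ ‖X‖ ^ 2 / 2 * (Real.exp ‖X‖ * trExp A) := by
    gcongr
    exact le_mul_of_one_le_left hnA (Real.one_le_exp (norm_nonneg X))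
  linarith

end TwoBases

/-! ### Moment generating function of the oracle noise -/

/-- The exponential moment that bounds the remainder of the trace exponential: the power series is
integrated termwise, and the moment bounds turn it into `∑ (k + 2).choose 2 * (c UE) ^ (k + 2)`. -/
lemma lintegral_sq_mul_exp_le {d : ℕ} {μ : Measure (Mat d)} {UE c : ℝ} (hU : 0 ≤ UE)
    (hc : 0 ≤ c) (hcU : c * UE < 1)
    (h : ∀ p : ℕ, 2 ≤ p → ∫⁻ A, ‖A‖ₑ ^ p ∂μ ≤ ENNReal.ofReal (p.factorial * UE ^ p / 2)) :
    ∫⁻ A, ENNReal.ofReal ((c * ‖A‖) ^ 2 * Real.exp (c * ‖A‖)) ∂μ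
      ≤ ENNReal.ofReal ((c * UE) ^ 2 / (1 - c * UE) ^ 3) := by
  have hu0 : 0 ≤ c * UE := mul_nonneg hc hU
  have hexp : ∀ y : ℝ, HasSum (fun k : ℕ => y ^ (k + 2) / k.factorial) (y ^ 2 * Real.exp y) := by
    intro y
    have h1 := (NormedSpace.expSeries_div_hasSum_exp (𝔸 := ℝ) y).mul_left (y ^ 2)
    rw [← Real.exp_eq_exp_ℝ] at h1
    convert! h1 using 2 with k
    ring
  have hpt : ∀ A : Mat d, ENNReal.ofReal ((c * ‖A‖) ^ 2 * Real.exp (c * ‖A‖))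
      = ∑' k : ℕ, ENNReal.ofReal (c ^ (k + 2) / k.factorial) * ‖A‖ₑ ^ (k + 2) := by
    intro A
    have h1 := hexp (c * ‖A‖)
    rw [← h1.tsum_eq, ENNReal.ofReal_tsum_of_nonneg (fun k => by positivity) h1.summable]
    refine tsum_congr fun k => ?_
    rw [← ofReal_norm, ← ENNReal.ofReal_pow (norm_nonneg _),
      ← ENNReal.ofReal_mul (by positivity)]
    congr 1
    ring
  simp_rw [hpt]
  rw [lintegral_tsum (fun k => by fun_prop)]
  have hgeo := (hasSum_choose_mul_geometric_of_norm_lt_one (𝕜 := ℝ) 2 (r := c * UE)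
    (by rwa [Real.norm_of_nonneg hu0])).mul_left ((c * UE) ^ 2)
  have hval : (c * UE) ^ 2 / (1 - c * UE) ^ 3 = (c * UE) ^ 2 * (1 / (1 - c * UE) ^ (2 + 1)) := by
    ring
  rw [hval, ← hgeo.tsum_eq, ENNReal.ofReal_tsum_of_nonneg (fun k => by positivity) hgeo.summable]
  refine ENNReal.tsum_le_tsum fun k => ?_
  rw [lintegral_const_mul _ (by fun_prop)]
  calc _ ≤ ENNReal.ofReal (c ^ (k + 2) / k.factorial)
        * ENNReal.ofReal ((k + 2).factorial * UE ^ (k + 2) / 2) := by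
        gcongr
        exact h (k + 2) (by omega)
    _ = _ := by
        rw [← ENNReal.ofReal_mul (by positivity)]
        congr 1
        have hch : ((k + 2).choose 2 : ℝ) = (k + 2) * (k + 1) / 2 := by
          rw [Nat.cast_choose_two]; push_cast; ring
        have hfac : ((k + 2).factorial : ℝ) = (k + 2) * (k + 1) * k.factorial := by
          rw [Nat.factorial_succ, Nat.factorial_succ]; push_cast; ring
        rw [hch, hfac]
        have : (k.factorial : ℝ) ≠ 0 := by positivity
        rw [mul_pow c UE 2, pow_add, pow_add, mul_pow c UE k]
        field_simp

/-- The growth factor of the trace exponential under one noise matrix scaled to have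
sub-exponential parameter `u`. -/
noncomputable def mgfBound (u : ℝ) : ℝ := 1 + u ^ 2 / (1 - u) ^ 3

lemma one_le_mgfBound {u : ℝ} (hu : u < 1) : 1 ≤ mgfBound u := by
  have : 0 < 1 - u := by linarith
  have : 0 ≤ u ^ 2 / (1 - u) ^ 3 := by positivity
  rw [mgfBound]; linarith

/-- One step of the supermartingale, for a fixed past `S`: the linear term of the expansion has mean
zero, and the remainder is a multiple of `trExp S`. -/
lemma lintegral_trExp_add_le {d : ℕ} {μ : Measure (Mat d)} [IsProbabilityMeasure μ] {UE θ : ℝ}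
    (hU : 0 ≤ UE) (hθ : |θ| * UE < 1)
    (h : ∀ p : ℕ, 2 ≤ p → ∫⁻ A, ‖A‖ₑ ^ p ∂μ ≤ ENNReal.ofReal (p.factorial * UE ^ p / 2))
    (hsymm : ∀ᵐ A ∂μ, IsSelfAdjoint A) (hmean : ∫ A, A ∂μ = 0) {S : Mat d}
    (hS : IsSelfAdjoint S) :
    ∫⁻ A, ENNReal.ofReal (trExp (S + θ • A)) ∂μ
      ≤ ENNReal.ofReal (mgfBound (|θ| * UE)) * ENNReal.ofReal (trExp S) := by
  obtain ⟨ℓ, hℓ⟩ := exists_trExp_add_le hS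
  have hS0 := trExp_nonneg hS
  have hden : 0 < 1 - |θ| * UE := by linarith
  set q : Mat d → ℝ := fun A => (|θ| * ‖A‖) ^ 2 * Real.exp (|θ| * ‖A‖) with hq
  have hq0 : ∀ A, 0 ≤ q A := fun A => by positivity
  have hqc : Continuous q := by fun_prop
  have hqle := lintegral_sq_mul_exp_le hU (abs_nonneg θ) hθ h
  have hqint : Integrable q μ := by
    refine ⟨hqc.aestronglyMeasurable, ?_⟩
    rw [hasFiniteIntegral_iff_ofReal (Filter.Eventually.of_forall hq0)]
    exact hqle.trans_lt ENNReal.ofReal_lt_top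
  have hsq : Integrable (fun A : Mat d => ‖A‖ ^ 2) μ := by
    refine ⟨by fun_prop, ?_⟩
    rw [hasFiniteIntegral_iff_enorm]
    simp only [enorm_pow, enorm_norm]
    exact (h 2 le_rfl).trans_lt ENNReal.ofReal_lt_top
  have hid : Integrable (fun A : Mat d => A) μ := by
    refine ((integrable_const (1 : ℝ)).add hsq).mono' (by fun_prop) ?_
    refine Filter.Eventually.of_forall fun A => ?_
    simp only [Pi.add_apply]
    nlinarith [sq_nonneg (‖A‖ - 1), norm_nonneg A]
  have hlin : Integrable (fun A : Mat d => ℓ (θ • A)) μ := ℓ.integrable_comp (hid.smul θ)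
  have hlin0 : ∫ A, ℓ (θ • A) ∂μ = 0 := by
    rw [ℓ.integral_comp_comm (φ := fun A => θ • A) (hid.smul θ), integral_smul, hmean]
    simp
  have hbound : ∀ᵐ A ∂μ, 0 ≤ trExp (S + θ • A) ∧
      trExp (S + θ • A) ≤ trExp S + ℓ (θ • A) + trExp S * q A := by
    filter_upwards [hsymm] with A hA
    have hA' := isSelfAdjoint_smul hA θ
    refine ⟨trExp_nonneg (isSelfAdjoint_add hS hA'), ?_⟩
    have := hℓ _ hA'
    rwa [norm_smul, Real.norm_eq_abs] at this
  have hgint : Integrable (fun A => trExp S + ℓ (θ • A) + trExp S * q A) μ :=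
    ((integrable_const _).add hlin).add (hqint.const_mul _)
  calc ∫⁻ A, ENNReal.ofReal (trExp (S + θ • A)) ∂μ
      ≤ ∫⁻ A, ENNReal.ofReal (trExp S + ℓ (θ • A) + trExp S * q A) ∂μ := by
        refine lintegral_mono_ae ?_
        filter_upwards [hbound] with A hA
        exact ENNReal.ofReal_le_ofReal hA.2
    _ = ENNReal.ofReal (∫ A, (trExp S + ℓ (θ • A) + trExp S * q A) ∂μ) := by
        rw [ofReal_integral_eq_lintegral_ofReal hgint]
        filter_upwards [hbound] with A hA
        exact hA.1.trans hA.2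
    _ ≤ _ := by
        rw [integral_add (f := fun A => trExp S + ℓ (θ • A))
            ((integrable_const _).add hlin) (hqint.const_mul _),
          integral_add (integrable_const _) hlin, hlin0, integral_const_mul,
          ← ENNReal.ofReal_mul (by linarith [one_le_mgfBound hθ])]
        refine ENNReal.ofReal_le_ofReal ?_
        have hqi : ∫ A, q A ∂μ ≤ (|θ| * UE) ^ 2 / (1 - |θ| * UE) ^ 3 := by
          rw [← ENNReal.ofReal_le_ofReal_iff (by positivity),
            ofReal_integral_eq_lintegral_ofReal hqint (Filter.Eventually.of_forall hq0)]
          exact hqle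
        simp only [integral_const, probReal_univ, one_smul, mgfBound]
        nlinarith

/-! ### The maximal inequality for sums of the noise matrices -/

/-- The joint law of the past and the fresh noise, for a query point that depends on the past
through `g ∘ Y`. -/
lemma map_prod_eq_compProd {Ω 𝒳 𝒴 𝒵 : Type*} {m mΩ : MeasurableSpace Ω} [MeasurableSpace 𝒳]
    [MeasurableSpace 𝒴] [MeasurableSpace 𝒵] {P : Measure Ω} [IsProbabilityMeasure P]
    (hm : m ≤ mΩ) {noise : Kernel 𝒳 𝒵} [IsMarkovKernel noise]
    {Y : Ω → 𝒴} {E : Ω → 𝒵} {g : 𝒴 → 𝒳} (hg : Measurable g) (hY : Measurable[m] Y)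
    (hE : Measurable E)
    (horacle : ∀ S : Set Ω, MeasurableSet[m] S → ∀ B : Set 𝒵, MeasurableSet B →
      P (S ∩ E ⁻¹' B) = ∫⁻ ω in S, noise (g (Y ω)) B ∂P)
    {B : Set Ω} (hB : MeasurableSet[m] B) :
    (P.restrict B).map (fun ω => (Y ω, E ω))
      = ((P.restrict B).map Y).compProd (noise.comap g hg) := by
  have hY' : Measurable Y := hY.mono hm le_rfl
  have : IsFiniteMeasure ((P.restrict B).map Y) := Measure.isFiniteMeasure_map _ _
  refine Measure.ext_prod fun {s t} hs ht => ?_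
  rw [Measure.map_apply (hY'.prodMk hE) (hs.prod ht), Measure.compProd_apply_prod hs ht,
    setLIntegral_map hs (Kernel.measurable_coe _ ht) hY',
    Measure.restrict_restrict (hY' hs), Measure.restrict_apply ((hY'.prodMk hE) (hs.prod ht))]
  have h1 : (fun ω => (Y ω, E ω)) ⁻¹' s ×ˢ t ∩ B = (Y ⁻¹' s ∩ B) ∩ E ⁻¹' t := by
    ext ω; simp; tauto
  rw [h1, horacle _ ((hY hs).inter hB) t ht]
  rfl

section Run

variable {d : ℕ} {Ω : Type*} {mΩ : MeasurableSpace Ω} {P : Measure Ω}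
  {f : Vec d → ℝ} {noise : Kernel (Vec d) (Mat d)} {W : ℕ → ℝ} {β ρ UE : ℝ} {x₀ : Vec d}
  {𝓕 : Filtration ℕ mΩ} {x : ℕ → Ω → Vec d} {E : ℕ → Ω → Mat d}

lemma IsRun.ae_isSelfAdjoint (hrun : IsRun P f noise W β ρ x₀ 𝓕 x E)
    (hnoise : IsSubexpNoise noise UE) : ∀ᵐ ω ∂P, ∀ t, IsSelfAdjoint (E t ω) := by
  rw [ae_all_iff]
  intro t
  have hclosed : IsClosed {A : Mat d | IsSelfAdjoint A} := by
    have : {A : Mat d | IsSelfAdjoint A} = {A | ContinuousLinearMap.adjoint A = A} := by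
      ext A; exact ContinuousLinearMap.isSelfAdjoint_iff'
    rw [this]
    exact isClosed_eq ContinuousLinearMap.adjoint.continuous continuous_id
  have h := hrun.oracle t Set.univ MeasurableSet.univ {A : Mat d | IsSelfAdjoint A}ᶜ
    hclosed.measurableSet.compl
  have h0 : ∀ ω, noise (x t ω) {A : Mat d | IsSelfAdjoint A}ᶜ = 0 := fun ω => hnoise.symm (x t ω)
  simp only [h0, lintegral_zero, Set.univ_inter] at h
  exact h

/-- The partial sums `E₀ + ⋯ + Eₙ₋₁` of the noise. -/
def noiseSum (E : ℕ → Ω → Mat d) (n : ℕ) (ω : Ω) : Mat d := ∑ i ∈ Finset.range n, E i ω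

lemma isSelfAdjoint_sum {ι : Type*} (s : Finset ι) {A : ι → Mat d}
    (h : ∀ i ∈ s, IsSelfAdjoint (A i)) : IsSelfAdjoint (∑ i ∈ s, A i) := by
  rw [ContinuousLinearMap.isSelfAdjoint_iff', map_sum]
  exact Finset.sum_congr rfl fun i hi => ContinuousLinearMap.isSelfAdjoint_iff'.1 (h i hi)

lemma IsRun.measurable_noiseSum (hrun : IsRun P f noise W β ρ x₀ 𝓕 x E) (n : ℕ) :
    Measurable[𝓕 n] (noiseSum E n) := by
  unfold noiseSum
  refine Finset.measurable_sum _ fun i hi => ?_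
  exact (hrun.measurable_noise i).mono (𝓕.mono (by have := Finset.mem_range.1 hi; omega)) le_rfl

/-- The supermartingale property, tested on an event `B` of the past. -/
lemma IsRun.setLIntegral_trExp_succ_le [IsProbabilityMeasure P]
    (hrun : IsRun P f noise W β ρ x₀ 𝓕 x E)
    (hnoise : IsSubexpNoise noise UE) (hU : 0 ≤ UE) {θ : ℝ} (hθ : |θ| * UE < 1) (n : ℕ)
    {B : Set Ω} (hB : MeasurableSet[𝓕 n] B) :
    ∫⁻ ω in B, ENNReal.ofReal (trExp (θ • noiseSum E (n + 1) ω)) ∂P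
      ≤ ENNReal.ofReal (mgfBound (|θ| * UE))
        * ∫⁻ ω in B, ENNReal.ofReal (trExp (θ • noiseSum E n ω)) ∂P := by
  have := hnoise.markov
  have hS := hrun.measurable_noiseSum n
  have hx := hrun.measurable_iterate n
  have hE : Measurable (E n) := (hrun.measurable_noise n).mono (𝓕.le _) le_rfl
  have hY : Measurable[𝓕 n] (fun ω => (noiseSum E n ω, x n ω)) := hS.prodMk hx
  have hlaw := map_prod_eq_compProd (𝓕.le n) measurable_snd hY hE (hrun.oracle n) hB
  have hYm : Measurable (fun ω => (noiseSum E n ω, x n ω)) := hY.mono (𝓕.le n) le_rfl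
  set F : (Mat d × Vec d) × Mat d → ENNReal :=
    fun z => ENNReal.ofReal (trExp (θ • z.1.1 + θ • z.2)) with hF
  have hFm : Measurable F := by
    have hlin : Measurable fun z : (Mat d × Vec d) × Mat d => θ • z.1.1 + θ • z.2 :=
      (measurable_fst.fst.const_smul θ).add (measurable_snd.const_smul θ)
    exact ENNReal.measurable_ofReal.comp (continuous_trExp.measurable.comp hlin)
  have h1 : ∀ ω, ENNReal.ofReal (trExp (θ • noiseSum E (n + 1) ω))
      = F ((noiseSum E n ω, x n ω), E n ω) := by
    intro ω
    simp only [hF, noiseSum, Finset.sum_range_succ, smul_add]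
  have h2 : ∫⁻ ω in B, F ((noiseSum E n ω, x n ω), E n ω) ∂P
      = ∫⁻ ω in B, ∫⁻ A, F ((noiseSum E n ω, x n ω), A) ∂(noise (x n ω)) ∂P := by
    rw [← lintegral_map (f := F) (g := fun ω => ((noiseSum E n ω, x n ω), E n ω)) hFm
      (hYm.prodMk hE), hlaw, Measure.lintegral_compProd hFm,
      lintegral_map (Measurable.lintegral_kernel_prod_right hFm) hYm]
    rfl
  simp_rw [h1]
  rw [h2, ← lintegral_const_mul' _ _ ENNReal.ofReal_ne_top]
  refine lintegral_mono_ae (ae_restrict_of_ae ?_)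
  filter_upwards [hrun.ae_isSelfAdjoint hnoise] with ω hω
  have hS : IsSelfAdjoint (θ • noiseSum E n ω) :=
    isSelfAdjoint_smul (isSelfAdjoint_sum _ fun i _ => hω i) θ
  have hpr : IsProbabilityMeasure (noise (x n ω)) := inferInstance
  have key := lintegral_trExp_add_le hU hθ (hnoise.subexp (x n ω)) (hnoise.symm (x n ω))
    (hnoise.mean_zero (x n ω)) hS
  exact key

/-- Ville's maximal inequality for the supermartingale `C⁻ⁿ tr exp (θ (E₀ + ⋯ + Eₙ₋₁))`. It is proved
by induction on `n`: the mass that has crossed the level `a` and the integral over the rest together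
grow at most by the factor `C` in each step. -/
lemma IsRun.ville [IsProbabilityMeasure P] (hrun : IsRun P f noise W β ρ x₀ 𝓕 x E)
    (hnoise : IsSubexpNoise noise UE) (hU : 0 ≤ UE) {θ : ℝ} (hθ : |θ| * UE < 1)
    (a : ENNReal) (n : ℕ) :
    a * P {ω | ∃ k < n + 1, a ≤ ENNReal.ofReal (trExp (θ • noiseSum E k ω))}
      ≤ ENNReal.ofReal (mgfBound (|θ| * UE)) ^ n * d := by
  set Φ : ℕ → Ω → ENNReal := fun k ω => ENNReal.ofReal (trExp (θ • noiseSum E k ω)) with hΦ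
  set A : ℕ → Set Ω := fun n => {ω | ∃ k < n, a ≤ Φ k ω} with hA
  set C := ENNReal.ofReal (mgfBound (|θ| * UE)) with hCdef
  have hΦm : ∀ k, Measurable[𝓕 k] (Φ k) := by
    intro k
    refine ENNReal.measurable_ofReal.comp (continuous_trExp.measurable.comp ?_)
    exact (hrun.measurable_noiseSum k).const_smul θ
  have hAm : ∀ n, MeasurableSet[𝓕 n] (A (n + 1)) := by
    intro n
    have : A (n + 1) = ⋃ k ∈ Set.Iio (n + 1), {ω | a ≤ Φ k ω} := by
      ext ω; simp [hA]
    rw [this]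
    refine MeasurableSet.biUnion (Set.to_countable _) fun k hk => ?_
    exact 𝓕.mono (Nat.lt_succ_iff.1 hk) _ (measurableSet_le measurable_const (hΦm k))
  have hAm' : ∀ n, MeasurableSet (A n) := by
    intro n
    rcases n with _ | n
    · simp [hA]
    · exact 𝓕.le n _ (hAm n)
  have hC : 1 ≤ C := by
    rw [← ENNReal.ofReal_one]
    exact ENNReal.ofReal_le_ofReal (one_le_mgfBound hθ)
  have hcross : ∀ n, a * P (A (n + 1)) + ∫⁻ ω in (A (n + 1))ᶜ, Φ n ω ∂P
      ≤ a * P (A n) + ∫⁻ ω in (A n)ᶜ, Φ n ω ∂P := by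
    intro n
    set D := (A n)ᶜ ∩ {ω | a ≤ Φ n ω} with hD
    have hDm : MeasurableSet D :=
      (hAm' n).compl.inter (𝓕.le n _ (measurableSet_le measurable_const (hΦm n)))
    have hsplit : A (n + 1) = A n ∪ D := by
      ext ω
      simp only [hD, hA, Set.mem_union, Set.mem_inter_iff, Set.mem_compl_iff, Set.mem_ofPred_eq]
      constructor
      · rintro ⟨k, hk, h⟩
        by_cases hex : ∃ k < n, a ≤ Φ k ω
        · exact Or.inl hex
        · refine Or.inr ⟨hex, ?_⟩
          rcases Nat.lt_succ_iff_lt_or_eq.1 hk with hk | rfl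
          · exact absurd ⟨k, hk, h⟩ hex
          · exact h
      · rintro (⟨k, hk, h⟩ | ⟨-, h⟩)
        · exact ⟨k, by omega, h⟩
        · exact ⟨n, by omega, h⟩
    have hcompl : (A n)ᶜ = D ∪ (A (n + 1))ᶜ := by
      rw [hsplit, Set.compl_union, Set.union_inter_distrib_left, Set.union_compl_self,
        Set.inter_univ, Set.union_eq_self_of_subset_left Set.inter_subset_left]
    have hdisj : Disjoint D (A (n + 1))ᶜ := by
      rw [hsplit, Set.disjoint_left]
      intro ω h1 h2
      exact h2 (Or.inr h1)
    have hI : ∫⁻ ω in (A n)ᶜ, Φ n ω ∂P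
        = ∫⁻ ω in D, Φ n ω ∂P + ∫⁻ ω in (A (n + 1))ᶜ, Φ n ω ∂P := by
      conv_lhs => rw [hcompl]
      exact lintegral_union (hAm' (n + 1)).compl hdisj
    have hDa : a * P D ≤ ∫⁻ ω in D, Φ n ω ∂P := by
      rw [← setLIntegral_const]
      exact setLIntegral_mono' hDm fun ω hω => hω.2
    have hP : P (A (n + 1)) ≤ P (A n) + P D := by
      rw [hsplit]; exact measure_union_le _ _
    rw [hI, ← add_assoc]
    gcongr
    calc a * P (A (n + 1)) ≤ a * (P (A n) + P D) := by gcongr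
      _ = a * P (A n) + a * P D := by ring
      _ ≤ _ := by gcongr
  have hmain : ∀ n, a * P (A n) + ∫⁻ ω in (A n)ᶜ, Φ n ω ∂P ≤ C ^ n * d := by
    intro n
    induction n with
    | zero => simp [hA, hΦ, noiseSum, trExp_zero]
    | succ n ih =>
      calc a * P (A (n + 1)) + ∫⁻ ω in (A (n + 1))ᶜ, Φ (n + 1) ω ∂P
          ≤ C * (a * P (A (n + 1))) + C * ∫⁻ ω in (A (n + 1))ᶜ, Φ n ω ∂P := by
            refine add_le_add (le_mul_of_one_le_left (by positivity) hC) ?_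
            exact hrun.setLIntegral_trExp_succ_le hnoise hU hθ n (hAm n).compl
        _ = C * (a * P (A (n + 1)) + ∫⁻ ω in (A (n + 1))ᶜ, Φ n ω ∂P) := by ring
        _ ≤ C * (C ^ n * d) := by
            gcongr
            exact (hcross n).trans ih
        _ = C ^ (n + 1) * d := by ring
  exact le_self_add.trans ((hcross n).trans (hmain n))

/-- Chernoff bound for the running maximum, from Ville's inequality and `1 + v ≤ exp v`. -/
lemma IsRun.measure_trExp_ge_le [IsProbabilityMeasure P] (hrun : IsRun P f noise W β ρ x₀ 𝓕 x E)
    (hnoise : IsSubexpNoise noise UE) (hU : 0 ≤ UE) {θ : ℝ} (hθ : |θ| * UE < 1)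
    (y : ℝ) (n : ℕ) :
    P {ω | ∃ k < n + 1, Real.exp y ≤ trExp (θ • noiseSum E k ω)}
      ≤ ENNReal.ofReal (d * Real.exp (-y + n * ((|θ| * UE) ^ 2 / (1 - |θ| * UE) ^ 3))) := by
  have hden : 0 < 1 - |θ| * UE := by linarith
  have hv := hrun.ville hnoise hU hθ (ENNReal.ofReal (Real.exp y)) n
  have hC : ENNReal.ofReal (mgfBound (|θ| * UE)) ^ n * d
      ≤ ENNReal.ofReal (Real.exp (n * ((|θ| * UE) ^ 2 / (1 - |θ| * UE) ^ 3)) * d) := by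
    rw [ENNReal.ofReal_mul (by positivity), ENNReal.ofReal_natCast, Real.exp_nat_mul,
      ENNReal.ofReal_pow (by positivity)]
    gcongr
    rw [mgfBound, add_comm]
    exact Real.add_one_le_exp _
  have hset : {ω | ∃ k < n + 1, Real.exp y ≤ trExp (θ • noiseSum E k ω)}
      ⊆ {ω | ∃ k < n + 1, ENNReal.ofReal (Real.exp y)
          ≤ ENNReal.ofReal (trExp (θ • noiseSum E k ω))} := by
    rintro ω ⟨k, hk, h⟩
    exact ⟨k, hk, ENNReal.ofReal_le_ofReal h⟩
  have he : ENNReal.ofReal (Real.exp (-y)) * ENNReal.ofReal (Real.exp y) = 1 := by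
    rw [← ENNReal.ofReal_mul (Real.exp_pos _).le, ← Real.exp_add]
    simp
  calc _ ≤ _ := measure_mono hset
    _ = ENNReal.ofReal (Real.exp (-y)) * (ENNReal.ofReal (Real.exp y)
        * P {ω | ∃ k < n + 1, ENNReal.ofReal (Real.exp y)
          ≤ ENNReal.ofReal (trExp (θ • noiseSum E k ω))}) := by
        rw [← mul_assoc, he, one_mul]
    _ ≤ ENNReal.ofReal (Real.exp (-y)) *
        ENNReal.ofReal (Real.exp (n * ((|θ| * UE) ^ 2 / (1 - |θ| * UE) ^ 3)) * d) := by
        gcongr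
        exact hv.trans hC
    _ = _ := by
        rw [← ENNReal.ofReal_mul (Real.exp_pos _).le, Real.exp_add]
        congr 1
        ring

/-- Maximal tail bound for the spectral norm of the noise sums; `u` is the free parameter of the
Chernoff bound. -/
lemma IsRun.measure_norm_noiseSum_ge_le [IsProbabilityMeasure P]
    (hrun : IsRun P f noise W β ρ x₀ 𝓕 x E) (hnoise : IsSubexpNoise noise UE) (hU : 0 < UE)
    (hd : 0 < d) {u : ℝ} (hu : 0 ≤ u) (hu1 : u < 1) (y : ℝ) (n : ℕ) :
    P {ω | ∃ k ≤ n, y ≤ ‖noiseSum E k ω‖}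
      ≤ ENNReal.ofReal (2 * d * Real.exp (-(u * y / UE) + n * (u ^ 2 / (1 - u) ^ 3))) := by
  have hθu : |u / UE| * UE = u := by
    rw [abs_of_nonneg (by positivity)]; field_simp
  have hθu' : |-(u / UE)| * UE = u := by rw [abs_neg, hθu]
  have h1 := hrun.measure_trExp_ge_le hnoise hU.le (θ := u / UE) (by rwa [hθu]) (u * y / UE) n
  have h2 := hrun.measure_trExp_ge_le hnoise hU.le (θ := -(u / UE)) (by rwa [hθu'])
    (u * y / UE) n
  rw [hθu] at h1
  rw [hθu'] at h2
  have hsub : ∀ᵐ ω ∂P, ω ∈ {ω | ∃ k ≤ n, y ≤ ‖noiseSum E k ω‖} →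
      ω ∈ {ω | ∃ k < n + 1, Real.exp (u * y / UE) ≤ trExp ((u / UE) • noiseSum E k ω)}
        ∪ {ω | ∃ k < n + 1, Real.exp (u * y / UE) ≤ trExp ((-(u / UE)) • noiseSum E k ω)} := by
    filter_upwards [hrun.ae_isSelfAdjoint hnoise] with ω hω
    rintro ⟨k, hk, h⟩
    have hS : IsSelfAdjoint (noiseSum E k ω) := isSelfAdjoint_sum _ fun i _ => hω i
    have hle : Real.exp (u * y / UE) ≤ Real.exp ‖(u / UE) • noiseSum E k ω‖ := by
      rw [norm_smul, Real.norm_of_nonneg (by positivity), Real.exp_le_exp, mul_div_right_comm]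
      gcongr
    rcases exp_norm_le_trExp_or hd (isSelfAdjoint_smul hS (u / UE)) with h' | h'
    · exact Or.inl ⟨k, by omega, hle.trans h'⟩
    · refine Or.inr ⟨k, by omega, ?_⟩
      have hneg : (-(u / UE)) • noiseSum E k ω = -((u / UE) • noiseSum E k ω) := by
        ext v; simp
      rw [hneg]
      exact hle.trans h'
  calc _ ≤ _ := measure_mono_ae hsub
    _ ≤ _ := measure_union_le _ _
    _ ≤ _ := add_le_add h1 h2
    _ = _ := by
      rw [← ENNReal.ofReal_add (by positivity) (by positivity)]
      congr 1
      ring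

end Run

/-! ### Gradient and Hessian of the objective -/

section Calculus

variable {d : ℕ} {f : Vec d → ℝ}

lemma contDiff_gradient (hf : ContDiff ℝ 2 f) : ContDiff ℝ 1 (gradient f) := by
  have h1 : ContDiff ℝ 1 (fderiv ℝ f) := hf.fderiv_right (by norm_num)
  exact (InnerProductSpace.toDual ℝ (Vec d)).symm.contDiff.comp h1

lemma hasFDerivAt_gradient (hf : ContDiff ℝ 2 f) (x : Vec d) :
    HasFDerivAt (gradient f) (hess f x) x :=
  ((contDiff_gradient hf).differentiable (by norm_num) x).hasFDerivAt

lemma fderiv_apply_eq_inner_gradient (x v : Vec d) : fderiv ℝ f x v = inner ℝ (gradient f x) v := by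
  rw [← toDual_gradient]; simp

/-- The bilinear form of the derivative of the gradient is the second derivative of `f`, whence its
symmetry. -/
lemma inner_hess_eq (hf : ContDiff ℝ 2 f) (x u v : Vec d) :
    inner ℝ (hess f x u) v = fderiv ℝ (fderiv ℝ f) x u v := by
  have h1 : (fun y => fderiv ℝ f y v) = fun y => inner ℝ (gradient f y) v := by
    ext y; exact fderiv_apply_eq_inner_gradient y v
  have hd : DifferentiableAt ℝ (fderiv ℝ f) x :=
    (hf.fderiv_right (m := 1) (by norm_num)).differentiable (by norm_num) x
  have h2 : HasFDerivAt (fun y => fderiv ℝ f y v)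
      ((ContinuousLinearMap.apply ℝ ℝ v).comp (fderiv ℝ (fderiv ℝ f) x)) x :=
    (ContinuousLinearMap.apply ℝ ℝ v).hasFDerivAt.comp x hd.hasFDerivAt
  have h3 : HasFDerivAt (fun y => inner ℝ (gradient f y) v)
      ((innerSL ℝ v).comp (hess f x)) x := by
    have := (innerSL ℝ v).hasFDerivAt.comp x (hasFDerivAt_gradient hf x)
    refine this.congr_of_eventuallyEq (Filter.Eventually.of_forall fun y => ?_)
    simp
  rw [h1] at h2
  have h4 := congrArg (fun T : Vec d →L[ℝ] ℝ => T u) (h2.unique h3)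
  simp only [ContinuousLinearMap.comp_apply, ContinuousLinearMap.apply_apply,
    innerSL_apply_apply] at h4
  rw [h4, real_inner_comm]

lemma isSelfAdjoint_hess (hf : ContDiff ℝ 2 f) (x : Vec d) : IsSelfAdjoint (hess f x) := by
  rw [ContinuousLinearMap.isSelfAdjoint_iff_isSymmetric]
  intro u v
  have hsymm : IsSymmSndFDerivAt ℝ f x := hf.contDiffAt.isSymmSndFDerivAt (by simp)
  simp only [ContinuousLinearMap.coe_coe]
  rw [inner_hess_eq hf, hsymm u v, real_inner_comm, inner_hess_eq hf]

lemma gradient_eq_zero_of_minimizer {xs : Vec d} (hxs : ∀ y, f xs ≤ f y) : gradient f xs = 0 := by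
  have h : fderiv ℝ f xs = 0 := IsLocalMin.fderiv_eq_zero (Filter.Eventually.of_forall hxs)
  simp [gradient, h]

/-- Taylor's formula of second order with the Lagrange remainder. -/
lemma exists_taylor (hf : ContDiff ℝ 2 f) (x v : Vec d) : ∃ s ∈ Set.Ioo (0 : ℝ) 1,
    f (x + v) = f x + inner ℝ (gradient f x) v + inner ℝ v (hess f (x + s • v) v) / 2 := by
  have hline : ∀ s : ℝ, HasDerivAt (fun s : ℝ => x + s • v) v s := fun s => by
    simpa using ((hasDerivAt_id s).smul_const v).const_add x
  have h1 : ∀ s : ℝ, HasDerivAt (fun s : ℝ => f (x + s • v))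
      (inner ℝ (gradient f (x + s • v)) v) s := fun s => by
    rw [← fderiv_apply_eq_inner_gradient]
    exact ((hf.differentiable (by norm_num) _).hasFDerivAt).comp_hasDerivAt s (hline s)
  have h2 : ∀ s : ℝ, HasDerivAt (fun s : ℝ => inner ℝ (gradient f (x + s • v)) v)
      (inner ℝ v (hess f (x + s • v) v)) s := fun s => by
    have := ((hasFDerivAt_gradient hf (x + s • v)).comp_hasDerivAt s (hline s)).inner ℝ
      (hasDerivAt_const s v)
    simpa [real_inner_comm] using this
  have h3 : ∀ s : ℝ, HasDerivAt
      (fun s : ℝ => f (x + s • v) - s * inner ℝ (gradient f x) v)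
      (inner ℝ (gradient f (x + s • v)) v - inner ℝ (gradient f x) v) s := fun s => by
    have := (h1 s).sub ((hasDerivAt_id s).mul_const (inner ℝ (gradient f x) v))
    rw [one_mul] at this
    exact this
  have h4 : ∀ s : ℝ, HasDerivAt (fun s : ℝ => s ^ 2) (2 * s) s := fun s => by
    simpa using hasDerivAt_pow 2 s
  obtain ⟨c, hc, hc'⟩ := exists_ratio_hasDerivAt_eq_ratio_slope _ _ (zero_lt_one' ℝ)
    (fun s _ => (h3 s).continuousAt.continuousWithinAt) (fun s _ => h3 s)
    (fun s : ℝ => s ^ 2) (fun s => 2 * s) (fun s _ => (h4 s).continuousAt.continuousWithinAt)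
    (fun s _ => h4 s)
  obtain ⟨e, he, he'⟩ := exists_hasDerivAt_eq_slope _ _ hc.1
    (fun s _ => (h2 s).continuousAt.continuousWithinAt) (fun s _ => h2 s)
  refine ⟨e, ⟨he.1, he.2.trans hc.2⟩, ?_⟩
  have hc0 : c ≠ 0 := hc.1.ne'
  rw [he']
  simp only [one_smul, zero_smul, add_zero, one_mul, zero_mul, sub_zero, one_pow] at hc' ⊢
  have hc2 : inner ℝ (gradient f (x + c • v)) v - inner ℝ (gradient f x) v
      = (f (x + v) - inner ℝ (gradient f x) v - f x) * (2 * c) := by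
    rw [← hc']; norm_num
  rw [hc2]
  field_simp
  ring

end Calculus

section Objective

variable {d : ℕ} {f : Vec d → ℝ} {lmin lmax L : ℝ} {xs : Vec d}

lemma IsObjective.taylor_le (hf : IsObjective f lmin lmax) (x v : Vec d) :
    f (x + v) ≤ f x + inner ℝ (gradient f x) v + lmax / 2 * ‖v‖ ^ 2 := by
  obtain ⟨s, -, h⟩ := exists_taylor hf.smooth x v
  rw [h]
  linarith [hf.upper (x + s • v) v]

lemma IsObjective.le_taylor (hf : IsObjective f lmin lmax) (x v : Vec d) :
    f x + inner ℝ (gradient f x) v + lmin / 2 * ‖v‖ ^ 2 ≤ f (x + v) := by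
  obtain ⟨s, -, h⟩ := exists_taylor hf.smooth x v
  rw [h]
  linarith [hf.lower (x + s • v) v]

lemma IsObjective.sq_norm_le_gap (hf : IsObjective f lmin lmax) (hxs : ∀ y, f xs ≤ f y)
    (x : Vec d) : lmin / 2 * ‖x - xs‖ ^ 2 ≤ f x - f xs := by
  have := hf.le_taylor xs (x - xs)
  rw [gradient_eq_zero_of_minimizer hxs, inner_zero_left, add_sub_cancel] at this
  linarith

lemma IsObjective.norm_hess_sub_le (hf : IsObjective f lmin lmax) (x y : Vec d) :
    ‖hess f x - hess f y‖ ≤ lmax := by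
  have hsymm : IsSelfAdjoint (hess f x - hess f y) := by
    have h := isSelfAdjoint_add (isSelfAdjoint_hess hf.smooth x)
      (isSelfAdjoint_smul (isSelfAdjoint_hess hf.smooth y) (-1))
    have he : hess f x - hess f y = hess f x + (-1 : ℝ) • hess f y := by
      ext v; simp [sub_eq_add_neg]
    rwa [he]
  have hpos := hf.pos
  refine norm_le_of_quadForm hsymm (hf.pos.le.trans hf.le) fun v => ?_
  rw [sub_apply, inner_sub_right, abs_le]
  have h0 : 0 ≤ lmin * ‖v‖ ^ 2 := by positivity
  constructor <;> linarith [hf.lower x v, hf.upper x v, hf.lower y v, hf.upper y v]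

/-- The linearization error of the gradient at the minimizer, by the mean value inequality. The
factor `1 / 2` of the sharp bound is not kept. -/
lemma norm_gradient_sub_hess_le (hf : ContDiff ℝ 2 f) (hxs : ∀ y, f xs ≤ f y) (hL : 0 ≤ L)
    (hLip : ∀ y z, ‖hess f y - hess f z‖ ≤ L * ‖y - z‖) (x : Vec d) :
    ‖gradient f x - hess f xs (x - xs)‖ ≤ L * ‖x - xs‖ * ‖x - xs‖ := by
  have h := (convex_closedBall xs ‖x - xs‖).norm_image_sub_le_of_norm_hasFDerivWithin_le'
    (f := gradient f) (f' := fun y => hess f y) (φ := hess f xs) (C := L * ‖x - xs‖)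
    (fun y _ => (hasFDerivAt_gradient hf y).hasFDerivWithinAt) (fun y hy => ?_)
    (Metric.mem_closedBall_self (norm_nonneg _)) (y := x) (by simp [dist_eq_norm])
  · simpa [gradient_eq_zero_of_minimizer hxs] using h
  · rw [Metric.mem_closedBall, dist_eq_norm] at hy
    exact (hLip y xs).trans (by gcongr)

/-! ### The norm weighted by the Hessian at the minimizer -/

lemma IsObjective.wnorm_sq (hf : IsObjective f lmin lmax) (x v : Vec d) :
    wnorm (hess f x) v ^ 2 = inner ℝ v (hess f x v) := by
  have hpos := hf.pos
  have h0 : 0 ≤ lmin * ‖v‖ ^ 2 := by positivity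
  exact Real.sq_sqrt (h0.trans (hf.lower x v))

lemma wnorm_nonneg (A : Mat d) (v : Vec d) : 0 ≤ wnorm A v := Real.sqrt_nonneg _

lemma IsObjective.sqrt_mul_norm_le_wnorm (hf : IsObjective f lmin lmax) (x v : Vec d) :
    Real.sqrt lmin * ‖v‖ ≤ wnorm (hess f x) v := by
  refine le_of_sq_le_sq ?_ (wnorm_nonneg _ _)
  rw [mul_pow, Real.sq_sqrt hf.pos.le, hf.wnorm_sq]
  exact hf.lower x v

lemma rpow_three_halves {l : ℝ} (hl : 0 < l) : l ^ (3 / 2 : ℝ) = l * Real.sqrt l := by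
  rw [show (3 / 2 : ℝ) = 1 + 1 / 2 by norm_num, Real.rpow_add hl, Real.rpow_one,
    Real.sqrt_eq_rpow]

/-- The distance to the minimizer relative to the scale `lmin ^ (3 / 2) / L` of the neighbourhoods
`nbhd`. -/
noncomputable def relDist (f : Vec d → ℝ) (xs : Vec d) (lmin L : ℝ) (x : Vec d) : ℝ :=
  L * wnorm (hess f xs) (x - xs) / (lmin * Real.sqrt lmin)

lemma relDist_nonneg (hL : 0 ≤ L) (hl : 0 < lmin) (x : Vec d) : 0 ≤ relDist f xs lmin L x := by
  have := wnorm_nonneg (hess f xs) (x - xs)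
  rw [relDist]
  positivity

lemma mem_nbhd_iff (hL : 0 < L) (hl : 0 < lmin) (ν : ℝ) (x : Vec d) :
    x ∈ nbhd (hess f xs) xs lmin L ν ↔ relDist f xs lmin L x ≤ ν := by
  have : 0 < lmin * Real.sqrt lmin := mul_pos hl (Real.sqrt_pos.2 hl)
  rw [nbhd, Set.mem_ofPred_eq, rpow_three_halves hl, relDist, le_div_iff₀ hL, div_le_iff₀ this]
  rw [mul_comm]

lemma IsObjective.norm_le_relDist (hf : IsObjective f lmin lmax) (hL : 0 < L) (x : Vec d) :
    L * ‖x - xs‖ ≤ relDist f xs lmin L x * lmin := by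
  have hl := hf.pos
  have hs : 0 < Real.sqrt lmin := Real.sqrt_pos.2 hl
  have h := hf.sqrt_mul_norm_le_wnorm xs (x - xs)
  have : relDist f xs lmin L x * lmin = L * (wnorm (hess f xs) (x - xs) / Real.sqrt lmin) := by
    rw [relDist]; field_simp
  rw [this]
  gcongr
  rw [le_div_iff₀ hs, mul_comm]
  exact h

/-- Near the minimizer the objective gap controls the weighted distance without the factor `κ`. -/
lemma IsObjective.relDist_le_of_gap (hf : IsObjective f lmin lmax) (hxs : ∀ y, f xs ≤ f y)
    (hL : 0 < L) (hLip : ∀ y z, ‖hess f y - hess f z‖ ≤ L * ‖y - z‖) {ν : ℝ} (hν : 0 < ν)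
    (hν' : ν ≤ 1 / 48) {x : Vec d}
    (hgap : 3 * L ^ 2 * (f x - f xs) ≤ ν ^ 2 * lmin ^ 3) : relDist f xs lmin L x ≤ ν := by
  have hl := hf.pos
  set r := ‖x - xs‖ with hr
  set w := wnorm (hess f xs) (x - xs) with hw
  have hr0 : 0 ≤ r := norm_nonneg _
  have h1 := hf.sq_norm_le_gap hxs x
  -- the distance is small in the Euclidean norm
  have h2 : L * r ≤ ν * lmin := by
    refine le_of_sq_le_sq ?_ (by positivity)
    have h3 : 3 * L ^ 2 * (lmin / 2 * r ^ 2) ≤ ν ^ 2 * lmin ^ 3 :=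
      (mul_le_mul_of_nonneg_left h1 (by positivity)).trans hgap
    have h4 : lmin * (3 / 2 * (L * r) ^ 2) ≤ lmin * (ν * lmin) ^ 2 := by
      refine le_trans (le_of_eq ?_) (h3.trans (le_of_eq ?_)) <;> ring
    have h5 := le_of_mul_le_mul_left h4 hl
    nlinarith [sq_nonneg (L * r)]
  obtain ⟨s, hs, htay⟩ := exists_taylor hf.smooth xs (x - xs)
  rw [gradient_eq_zero_of_minimizer hxs, inner_zero_left, add_sub_cancel, add_zero] at htay
  have hw2 : w ^ 2 = inner ℝ (x - xs) (hess f xs (x - xs)) := hf.wnorm_sq xs (x - xs)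
  have hlow : lmin * r ^ 2 ≤ w ^ 2 := hw2 ▸ hf.lower xs (x - xs)
  have hdiff : inner ℝ (x - xs) (hess f xs (x - xs))
      - inner ℝ (x - xs) (hess f (xs + s • (x - xs)) (x - xs)) ≤ L * r * r ^ 2 := by
    rw [← inner_sub_right, ← sub_apply]
    refine (real_inner_le_norm _ _).trans ?_
    have h6 := (hess f xs - hess f (xs + s • (x - xs))).le_opNorm (x - xs)
    have h7 := hLip xs (xs + s • (x - xs))
    have h8 : ‖xs - (xs + s • (x - xs))‖ ≤ r := by
      rw [sub_add_cancel_left, norm_neg, norm_smul, Real.norm_of_nonneg hs.1.le]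
      exact mul_le_of_le_one_left hr0 hs.2.le
    calc r * ‖(hess f xs - hess f (xs + s • (x - xs))) (x - xs)‖
        ≤ r * (L * r * r) := by
          gcongr
          refine h6.trans ?_
          gcongr
          exact h7.trans (by gcongr)
      _ = L * r * r ^ 2 := by ring
  -- `w² ≤ 2 (f x - f xs) + ν w²`
  have h9 : w ^ 2 * (1 - ν) ≤ 2 * (f x - f xs) := by
    have h10 : L * r * r ^ 2 ≤ ν * lmin * r ^ 2 := by gcongr
    nlinarith
  have h11 : 3 * L ^ 2 * (w ^ 2 * (1 - ν)) ≤ 2 * (ν ^ 2 * lmin ^ 3) := by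
    have := mul_le_mul_of_nonneg_left h9 (by positivity : 0 ≤ 3 * L ^ 2)
    linarith
  have h12 : (L * w) ^ 2 ≤ (ν * (lmin * Real.sqrt lmin)) ^ 2 := by
    have h13 : (ν * (lmin * Real.sqrt lmin)) ^ 2 = ν ^ 2 * lmin ^ 3 := by
      rw [mul_pow, mul_pow, Real.sq_sqrt hl.le]; ring
    rw [h13]
    nlinarith [sq_nonneg (L * w)]
  rw [relDist, div_le_iff₀ (by positivity)]
  exact le_of_sq_le_sq h12 (by positivity)

end Objective

/-! ### One step of the Newton method -/

section Step

variable {d : ℕ} {f : Vec d → ℝ} {lmin lmax L : ℝ} {xs : Vec d} {β ρ : ℝ} {A : Mat d}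
  {x x' : Vec d}

lemma NewtonStep.le (h : NewtonStep f β ρ A x x') (hβ : 0 < β) (hρ : 0 < ρ) : f x' ≤ f x := by
  rcases h with ⟨p, -, hp, j, hj, rfl⟩ | ⟨-, rfl⟩
  · have h1 := hj.1
    have h2 : ρ ^ j * β * inner ℝ (gradient f x) p ≤ 0 :=
      mul_nonpos_of_nonneg_of_nonpos (by positivity) hp.le
    exact h1.trans (by linarith)
  · exact le_rfl

/-- If the averaged Hessian is positive definite, the step is a damped Newton step. At a stationary
point this holds with the direction `0`. -/
lemma NewtonStep.exists_direction (h : NewtonStep f β ρ A x x') {a : ℝ} (ha : 0 < a)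
    (hA : ∀ v : Vec d, a * ‖v‖ ^ 2 ≤ inner ℝ v (A v)) :
    ∃ p : Vec d, A p = -gradient f x ∧ ∃ j : ℕ,
      IsLeast {i : ℕ | f (x + ρ ^ i • p) ≤ f x + ρ ^ i * β * inner ℝ (gradient f x) p} j ∧
      x' = x + ρ ^ j • p := by
  rcases h with ⟨p, h1, -, h2⟩ | ⟨h, rfl⟩
  · exact ⟨p, h1, h2⟩
  · have hinj : Function.Injective (A : Vec d →ₗ[ℝ] Vec d) := by
      rw [injective_iff_map_eq_zero]
      intro v hv
      have hv' : A v = 0 := hv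
      have h1 := hA v
      rw [hv', inner_zero_right] at h1
      have h2 : ‖v‖ ^ 2 ≤ 0 := by nlinarith
      simpa using le_antisymm h2 (sq_nonneg _)
    obtain ⟨p, hp⟩ := LinearMap.injective_iff_surjective.1 hinj (-gradient f x')
    have hp' : A p = -gradient f x' := hp
    have h1 := hA p
    have h2 := h p hp'
    have h3 : inner ℝ p (A p) = -inner ℝ (gradient f x') p := by
      rw [hp', inner_neg_right, real_inner_comm]
    have h4 : ‖p‖ ^ 2 ≤ 0 := by nlinarith
    have h5 : p = 0 := by simpa using le_antisymm h4 (sq_nonneg _)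
    refine ⟨p, hp', 0, ⟨?_, fun _ _ => Nat.zero_le _⟩, ?_⟩ <;> simp [h5]

/-- The objective gap is at most the Newton decrement of any positive definite model. -/
lemma IsObjective.gap_le_decrement (hf : IsObjective f lmin lmax) {Λ : ℝ} (hΛ : 0 < Λ)
    (hA : IsSelfAdjoint A) (hA0 : ∀ v : Vec d, 0 ≤ inner ℝ v (A v))
    (hAΛ : ∀ v : Vec d, inner ℝ v (A v) ≤ Λ * ‖v‖ ^ 2) {p : Vec d} (hp : A p = -gradient f x) :
    f x - f xs ≤ inner ℝ p (A p) * (Λ / (2 * lmin)) := by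
  have hl := hf.pos
  have hs : ∀ u v : Vec d, inner ℝ (A u) v = inner ℝ u (A v) := fun u v =>
    ContinuousLinearMap.isSelfAdjoint_iff_isSymmetric.1 hA u v
  have h1 := hf.le_taylor x (xs - x)
  rw [add_sub_cancel] at h1
  set w := xs - x with hw
  have h2 : inner ℝ (gradient f x) w = -inner ℝ p (A w) := by
    rw [← hs, hp, inner_neg_left, neg_neg]
  -- the quadratic form of `A` at `p - (lmin / Λ) w` is nonnegative
  have h3 := hA0 (p - (lmin / Λ) • w)
  have h4 : inner ℝ (p - (lmin / Λ) • w) (A (p - (lmin / Λ) • w))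
      = inner ℝ p (A p) - 2 * (lmin / Λ) * inner ℝ p (A w)
        + (lmin / Λ) ^ 2 * inner ℝ w (A w) := by
    simp only [map_sub, map_smul, inner_sub_left, inner_sub_right, inner_smul_left,
      inner_smul_right]
    rw [show inner ℝ w (A p) = inner ℝ p (A w) by rw [← hs, real_inner_comm]]
    simp
    ring
  rw [h4] at h3
  have h5 : (lmin / Λ) ^ 2 * inner ℝ w (A w) ≤ (lmin / Λ) ^ 2 * (Λ * ‖w‖ ^ 2) := by
    gcongr; exact hAΛ w
  have h6 : 2 * (lmin / Λ) * inner ℝ p (A w) ≤ inner ℝ p (A p) + lmin ^ 2 / Λ * ‖w‖ ^ 2 := by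
    have : (lmin / Λ) ^ 2 * (Λ * ‖w‖ ^ 2) = lmin ^ 2 / Λ * ‖w‖ ^ 2 := by field_simp
    linarith
  have h7 : inner ℝ p (A w) ≤ inner ℝ p (A p) * (Λ / (2 * lmin)) + lmin / 2 * ‖w‖ ^ 2 := by
    have h8 := mul_le_mul_of_nonneg_left h6 (by positivity : 0 ≤ Λ / (2 * lmin))
    refine le_trans (le_of_eq ?_) (h8.trans (le_of_eq ?_)) <;> field_simp
  linarith

/-- The inequality behind the linear rate when the unit step is taken although the guaranteed lower
bound `c` of the step size exceeds one. -/
lemma unit_step_rate {a c β ρ : ℝ} (ha : a = ρ * (1 - β)) (hβ : 0 < β) (hβ' : β < 1 / 2)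
    (hρ : 0 < ρ) (hρ' : ρ < 1) (hc : 1 ≤ c) (hc' : c ≤ 2 * a) : β * c ≤ 1 - a / c := by
  have ha0 : 0 < a := by rw [ha]; exact mul_pos hρ (by linarith)
  have h1 : a ≤ 1 - β := by rw [ha]; nlinarith
  have h2 : a * β ≤ 1 / 4 := by nlinarith [sq_nonneg (β - 1 / 2)]
  have hc0 : 0 < c := by linarith
  have h3 : β * c ^ 2 ≤ c - a := by
    -- the concave function `c - a - β c²` is nonnegative at both end points of `[1, 2 a]`
    rcases eq_or_lt_of_le (hc.trans hc') with h | h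
    · have : c = 1 := by linarith
      subst this; linarith
    · have h4 : 0 ≤ (2 * a - c) * (1 - a - β) := mul_nonneg (by linarith) (by linarith)
      have h5 : 0 ≤ (c - 1) * (a - 4 * a * (a * β)) := mul_nonneg (by linarith) (by nlinarith)
      have h6 : 0 ≤ (2 * a - 1) * β * ((2 * a - c) * (c - 1)) :=
        mul_nonneg (mul_nonneg (by linarith) hβ.le) (mul_nonneg (by linarith) (by linarith))
      have h7 : (2 * a - 1) * (c - a - β * c ^ 2) = (2 * a - c) * (1 - a - β)
          + (c - 1) * (a - 4 * a * (a * β)) + (2 * a - 1) * β * ((2 * a - c) * (c - 1)) := by ring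
      have h8 : 0 ≤ (2 * a - 1) * (c - a - β * c ^ 2) := by rw [h7]; positivity
      have := nonneg_of_mul_nonneg_right h8 (by linarith)
      linarith
  have h9 : 1 - a / c = (c - a) / c := by field_simp
  rw [h9, le_div_iff₀ hc0]
  linarith

/-- Linear decrease of the objective gap, given an averaged Hessian with spectrum in
`[(1 - ε) lmin, (1 + ε) lmax]`. -/
lemma NewtonStep.gap_le (h : NewtonStep f β ρ A x x') (hf : IsObjective f lmin lmax)
    (hβ : 0 < β) (hβ' : β < 1 / 2) (hρ : 0 < ρ) (hρ' : ρ < 1)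
    {ε : ℝ} (hε : 0 < ε) (hε' : ε < 1) (hA : IsSelfAdjoint A)
    (hlow : ∀ v : Vec d, (1 - ε) * lmin * ‖v‖ ^ 2 ≤ inner ℝ v (A v))
    (hupp : ∀ v : Vec d, inner ℝ v (A v) ≤ (1 + ε) * lmax * ‖v‖ ^ 2) :
    f x' - f xs ≤ (1 - linRate (lmax / lmin) β ρ ε) * (f x - f xs) := by
  have hl := hf.pos
  have hlm : 0 < lmax := hl.trans_le hf.le
  have hε1 : 0 < 1 - ε := by linarith
  obtain ⟨p, hp, j, hj, rfl⟩ := h.exists_direction (mul_pos hε1 hl) hlow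
  have hq := hf.gap_le_decrement (xs := xs) (mul_pos (by linarith : 0 < 1 + ε) hlm) hA
    (fun v => le_trans (by positivity) (hlow v)) hupp hp
  set q := inner ℝ p (A p) with hqdef
  have hgp : inner ℝ (gradient f x) p = -q := by
    rw [hqdef, hp, inner_neg_right, neg_neg, real_inner_comm]
  have hpq : (1 - ε) * lmin * ‖p‖ ^ 2 ≤ q := hlow p
  have hq0 : 0 ≤ q := le_trans (by positivity) hpq
  set κ := lmax / lmin with hκ
  have hκ0 : 0 < κ := by positivity
  set c := 2 * ρ * (1 - β) * (1 - ε) / κ with hc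
  have hβ1 : 0 < 1 - β := by linarith
  have hc0 : 0 < c := by positivity
  -- the rate `linRate` is `β c` times the ratio of decrement and gap
  have hrate : linRate κ β ρ ε * (f x - f xs) ≤ β * c * q := by
    have h1 : linRate κ β ρ ε = β * c * (2 / (κ * (1 + ε))) := by
      rw [linRate, hc]; field_simp; ring
    have h2 : 2 / (κ * (1 + ε)) * (f x - f xs) ≤ q := by
      have h3 : (1 + ε) * lmax / (2 * lmin) = κ * (1 + ε) / 2 := by rw [hκ]; field_simp
      rw [h3] at hq
      have h4 := mul_le_mul_of_nonneg_left hq (by positivity : 0 ≤ 2 / (κ * (1 + ε)))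
      refine h4.trans (le_of_eq ?_)
      field_simp
    rw [h1, mul_assoc (β * c)]
    exact mul_le_mul_of_nonneg_left h2 (by positivity)
  suffices hdec : f (x + ρ ^ j • p) ≤ f x - β * c * q by linarith
  have harm := hj.1
  rw [Set.mem_ofPred_eq, hgp] at harm
  -- upper model of the objective along the direction `p`
  have hmodel : ∀ s : ℝ, f (x + s • p) ≤ f x - s * q + s ^ 2 * (κ / (2 * (1 - ε)) * q) := by
    intro s
    have h1 := hf.taylor_le x (s • p)
    rw [inner_smul_right, hgp, norm_smul, mul_pow, Real.norm_eq_abs, sq_abs] at h1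
    have h2 : lmax / 2 * ‖p‖ ^ 2 ≤ κ / (2 * (1 - ε)) * q := by
      have h3 := mul_le_mul_of_nonneg_left hpq (by positivity : 0 ≤ κ / (2 * (1 - ε)))
      refine le_trans (le_of_eq ?_) h3
      rw [hκ]; field_simp
    nlinarith [mul_le_mul_of_nonneg_left h2 (sq_nonneg s)]
  have hκc : κ / (2 * (1 - ε)) = ρ * (1 - β) / c := by rw [hc]; field_simp
  rcases j with _ | i
  · rw [pow_zero, one_smul] at harm ⊢
    rcases le_total c 1 with hc1 | hc1
    · have : β * c * q ≤ β * q := by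
        rw [mul_assoc]; gcongr; exact mul_le_of_le_one_left hq0 hc1
      linarith
    · have h1 := hmodel 1
      rw [one_smul, hκc] at h1
      have hκ1 : 1 ≤ κ := (one_le_div hl).2 hf.le
      have hc2 : c ≤ 2 * (ρ * (1 - β)) := by
        rw [hc, div_le_iff₀ hκ0]
        have : 0 < ρ * (1 - β) := by positivity
        nlinarith
      have h2 := unit_step_rate rfl hβ hβ' hρ hρ' hc1 hc2
      have h3 := mul_le_mul_of_nonneg_right h2 hq0
      nlinarith
  · -- the larger step `ρ ^ i` violates the Armijo condition, hence it is at least `c / ρ`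
    have hnot : ¬ f (x + ρ ^ i • p) ≤ f x + ρ ^ i * β * -q := fun hi => by
      have : i + 1 ≤ i := hj.2 (by rw [Set.mem_ofPred_eq, hgp]; exact hi)
      omega
    rw [not_le] at hnot
    have h1 := hmodel (ρ ^ i)
    have hs : 0 < ρ ^ i := by positivity
    have h2 : 0 < ρ ^ i * (q * (ρ ^ i * (κ / (2 * (1 - ε))) - (1 - β))) := by nlinarith
    have h3 : 0 < q * (ρ ^ i * (κ / (2 * (1 - ε))) - (1 - β)) := pos_of_mul_pos_right h2 hs.le
    have h4 : 0 < ρ ^ i * (κ / (2 * (1 - ε))) - (1 - β) := pos_of_mul_pos_right h3 hq0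
    have h5 : c ≤ ρ ^ (i + 1) := by
      rw [hκc] at h4
      have h6 : ρ ^ i * (ρ * (1 - β) / c) = ρ ^ (i + 1) * (1 - β) / c := by
        rw [pow_succ]; ring
      rw [h6, sub_pos, lt_div_iff₀ hc0, mul_comm] at h4
      exact (lt_of_mul_lt_mul_right h4 hβ1.le).le
    have h7 : β * c * q ≤ ρ ^ (i + 1) * β * q := by
      rw [mul_comm β c]; gcongr
    linarith

lemma abs_inner_le_opNorm (B : Mat d) (u v : Vec d) : |inner ℝ u (B v)| ≤ ‖B‖ * ‖u‖ * ‖v‖ := by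
  refine (abs_real_inner_le_norm _ _).trans ?_
  have := mul_le_mul_of_nonneg_left (B.le_opNorm v) (norm_nonneg u)
  linarith

/-- Local contraction of the Newton step: near the minimizer the unit step is accepted, and the
distance to the minimizer shrinks by the relative error of the averaged Hessian plus the current
relative distance. -/
lemma NewtonStep.local_contraction (h : NewtonStep f β ρ A x x') (hf : IsObjective f lmin lmax)
    (hxs : ∀ y, f xs ≤ f y) (hL : 0 < L)
    (hLip : ∀ y z, ‖hess f y - hess f z‖ ≤ L * ‖y - z‖)
    {η ν : ℝ} (hAη : ‖A - hess f xs‖ ≤ η * lmin)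
    (hν : relDist f xs lmin L x ≤ ν) (hην : η + ν ≤ 1 - η)
    (hη1 : η < 1) (hunit : (1 + ν) / 2 ≤ (1 - β) * (1 - η)) :
    wnorm (hess f xs) (x' - xs) * (1 - η)
      ≤ (η + relDist f xs lmin L x) * wnorm (hess f xs) (x - xs) := by
  have hl := hf.pos
  set Hs := hess f xs with hHs
  set z := relDist f xs lmin L x with hz
  have hz0 : 0 ≤ z := relDist_nonneg hL.le hl x
  have hη0 : 0 ≤ η := by
    have := (norm_nonneg _).trans hAη
    exact nonneg_of_mul_nonneg_left this hl
  have hw2 : ∀ v, wnorm Hs v ^ 2 = inner ℝ v (Hs v) := hf.wnorm_sq xs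
  have hwl : ∀ v, lmin * ‖v‖ ^ 2 ≤ wnorm Hs v ^ 2 := fun v => (hw2 v) ▸ hf.lower xs v
  have hww : ∀ u v, lmin * ‖u‖ * ‖v‖ ≤ wnorm Hs u * wnorm Hs v := by
    intro u v
    have h1 := hf.sqrt_mul_norm_le_wnorm xs u
    have h2 := hf.sqrt_mul_norm_le_wnorm xs v
    have h3 := mul_le_mul h1 h2 (by positivity) (wnorm_nonneg _ _)
    have h4 := Real.mul_self_sqrt hl.le
    calc lmin * ‖u‖ * ‖v‖ = (Real.sqrt lmin * ‖u‖) * (Real.sqrt lmin * ‖v‖) := by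
          linear_combination (-‖u‖ * ‖v‖) * h4
      _ ≤ _ := h3
  have hdiff : ∀ u v, |inner ℝ u ((A - Hs) v)| ≤ η * (wnorm Hs u * wnorm Hs v) := by
    intro u v
    refine (abs_inner_le_opNorm _ u v).trans ?_
    calc ‖A - Hs‖ * ‖u‖ * ‖v‖ ≤ η * lmin * ‖u‖ * ‖v‖ := by gcongr
      _ = η * (lmin * ‖u‖ * ‖v‖) := by ring
      _ ≤ _ := mul_le_mul_of_nonneg_left (hww u v) hη0
  have hlow : ∀ v, (1 - η) * wnorm Hs v ^ 2 ≤ inner ℝ v (A v) := by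
    intro v
    have h1 := neg_le_of_abs_le (hdiff v v)
    rw [sub_apply, inner_sub_right, ← hw2] at h1
    linarith
  obtain ⟨p, hp, j, hj, rfl⟩ := h.exists_direction (a := (1 - η) * lmin)
    (mul_pos (by linarith) hl) (fun v => by
      refine le_trans ?_ (hlow v)
      rw [mul_assoc]
      exact mul_le_mul_of_nonneg_left (hwl v) (by linarith))
  set v := x - xs with hv
  -- contraction of the full Newton step
  have hfull : wnorm Hs (v + p) * (1 - η) ≤ (η + z) * wnorm Hs v := by
    have h1 := hlow (v + p)
    have h2 : A (v + p) = (A - Hs) v + (Hs v - gradient f x) := by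
      rw [map_add, hp, sub_apply]; abel
    have h3 := norm_gradient_sub_hess_le hf.smooth hxs hL.le hLip x
    have h4 : inner ℝ (v + p) (Hs v - gradient f x) ≤ z * (wnorm Hs (v + p) * wnorm Hs v) := by
      refine (real_inner_le_norm _ _).trans ?_
      rw [norm_sub_rev]
      calc ‖v + p‖ * ‖gradient f x - Hs v‖ ≤ ‖v + p‖ * (L * ‖v‖ * ‖v‖) := by gcongr
        _ ≤ ‖v + p‖ * (z * lmin * ‖v‖) := by
            have hLv : L * ‖v‖ ≤ z * lmin := hf.norm_le_relDist hL x
            exact mul_le_mul_of_nonneg_left (mul_le_mul_of_nonneg_right hLv (norm_nonneg v))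
              (norm_nonneg _)
        _ = z * (lmin * ‖v + p‖ * ‖v‖) := by ring
        _ ≤ _ := mul_le_mul_of_nonneg_left (hww _ _) hz0
    have h5 := le_of_abs_le (hdiff (v + p) v)
    rw [h2, inner_add_right] at h1
    rcases eq_or_lt_of_le (wnorm_nonneg Hs (v + p)) with h6 | h6
    · rw [← h6, zero_mul]
      exact mul_nonneg (by linarith) (wnorm_nonneg _ _)
    · refine le_of_mul_le_mul_left ?_ h6
      nlinarith
  -- every point of the segment between the two iterates is as close to the minimizer
  have hwle : wnorm Hs (v + p) ≤ wnorm Hs v := by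
    have h1 : (η + z) * wnorm Hs v ≤ (1 - η) * wnorm Hs v :=
      mul_le_mul_of_nonneg_right (by linarith) (wnorm_nonneg _ _)
    have h2 : (1 - η) * wnorm Hs (v + p) ≤ (1 - η) * wnorm Hs v := by linarith
    exact le_of_mul_le_mul_left h2 (by linarith)
  have hzdef : z = L * wnorm Hs v / (lmin * Real.sqrt lmin) := rfl
  have hsl : 0 < Real.sqrt lmin := Real.sqrt_pos.2 hl
  have hball : ∀ u, wnorm Hs u ≤ wnorm Hs v → L * ‖u‖ ≤ ν * lmin := by
    intro u hu
    have h1 := (hf.sqrt_mul_norm_le_wnorm xs u).trans hu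
    have h2 : L * wnorm Hs v = z * (lmin * Real.sqrt lmin) := by rw [hzdef]; field_simp
    have h3 : Real.sqrt lmin * (L * ‖u‖) ≤ Real.sqrt lmin * (z * lmin) := by
      nlinarith
    exact (le_of_mul_le_mul_left h3 hsl).trans (by gcongr)
  have hz0j : j = 0 := by
    refine Nat.le_zero.1 (hj.2 ?_)
    rw [Set.mem_ofPred_eq, pow_zero, one_smul]
    obtain ⟨s, hs, htay⟩ := exists_taylor hf.smooth x p
    have hseg : L * ‖x + s • p - xs‖ ≤ ν * lmin := by
      have h1 : x + s • p - xs = (1 - s) • v + s • (v + p) := by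
        rw [hv]; module
      have h2 : ‖x + s • p - xs‖ ≤ (1 - s) * ‖v‖ + s * ‖v + p‖ := by
        rw [h1]
        refine (norm_add_le _ _).trans ?_
        rw [norm_smul, norm_smul, Real.norm_of_nonneg hs.1.le,
          Real.norm_of_nonneg (by linarith [hs.2])]
      have h3 := hball v le_rfl
      have h4 := hball (v + p) hwle
      have h5 := mul_le_mul_of_nonneg_left h2 hL.le
      nlinarith [mul_le_mul_of_nonneg_left h3 (by linarith [hs.2] : 0 ≤ 1 - s),
        mul_le_mul_of_nonneg_left h4 hs.1.le]
    have hH : inner ℝ p (hess f (x + s • p) p) ≤ (1 + ν) * wnorm Hs p ^ 2 := by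
      have h1 := le_of_abs_le (abs_inner_le_opNorm (hess f (x + s • p) - Hs) p p)
      rw [sub_apply, inner_sub_right, ← hw2] at h1
      have h2 := (hLip (x + s • p) xs).trans hseg
      have h3 : ‖hess f (x + s • p) - Hs‖ * ‖p‖ * ‖p‖ ≤ ν * lmin * ‖p‖ * ‖p‖ := by gcongr
      have h4 := mul_le_mul_of_nonneg_left (hwl p) (hz0.trans hν)
      nlinarith
    have hq := hlow p
    have hgp : inner ℝ (gradient f x) p = -inner ℝ p (A p) := by
      rw [hp, inner_neg_right, neg_neg, real_inner_comm]
    rw [htay, hgp]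
    have h6 : (1 + ν) / 2 * wnorm Hs p ^ 2 ≤ (1 - β) * inner ℝ p (A p) := by
      have hβ1 : 0 ≤ 1 - β := by
        by_contra hneg
        have h8 : (1 - β) * (1 - η) < 0 := mul_neg_of_neg_of_pos (by linarith) (by linarith)
        linarith
      calc (1 + ν) / 2 * wnorm Hs p ^ 2 ≤ (1 - β) * (1 - η) * wnorm Hs p ^ 2 := by gcongr
        _ = (1 - β) * ((1 - η) * wnorm Hs p ^ 2) := by ring
        _ ≤ _ := by gcongr
    linarith
  rw [hz0j, pow_zero, one_smul, show x + p - xs = v + p by rw [hv]; abel]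
  exact hfull

end Step

/-! ### Convergence along one sample path -/

lemma avgHessian_uniformWeights {d : ℕ} (H : ℕ → Mat d) (t : ℕ) :
    avgHessian uniformWeights H (t + 1)
      = ((t : ℝ) + 1)⁻¹ • ∑ i ∈ Finset.range (t + 1), H i := by
  have key : ∀ n : ℕ, (n : ℝ) • avgHessian uniformWeights H n = ∑ i ∈ Finset.range n, H i := by
    intro n
    induction n with
    | zero => ext v; simp [avgHessian]
    | succ n ih =>
      have hn : ((n : ℝ) + 1) ≠ 0 := by positivity
      have h1 : ((n : ℝ) + 1) * (n / (n + 1)) = n := by field_simp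
      have h2 : ((n : ℝ) + 1) * (1 - n / (n + 1)) = 1 := by field_simp; ring
      rw [Finset.sum_range_succ, ← ih, avgHessian]
      simp only [uniformWeights]
      push_cast
      rw [smul_add, smul_smul, smul_smul, h1, h2, one_smul]
  have hn : ((t : ℝ) + 1) ≠ 0 := by positivity
  rw [← key (t + 1)]
  push_cast
  rw [smul_smul, inv_mul_cancel₀ hn, one_smul]

section Path

variable {d : ℕ} {f : Vec d → ℝ} {lmin lmax L : ℝ} {xs : Vec d} {β ρ ε ν : ℝ}
  {x : ℕ → Vec d} {E : ℕ → Mat d}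

/-- The averaged Hessian after the query at time `t`. -/
noncomputable def pathHessian (f : Vec d → ℝ) (x : ℕ → Vec d) (E : ℕ → Mat d) (t : ℕ) : Mat d :=
  avgHessian uniformWeights (fun i => hess f (x i) + E i) (t + 1)

/-- The norm of the averaged noise at time `t`, relative to `lmin`. -/
noncomputable def relNoise (E : ℕ → Mat d) (lmin : ℝ) (t : ℕ) : ℝ :=
  ‖∑ i ∈ Finset.range (t + 1), E i‖ / ((t + 1) * lmin)

lemma pathHessian_eq (t : ℕ) : pathHessian f x E t
    = ((t : ℝ) + 1)⁻¹ • ∑ i ∈ Finset.range (t + 1), hess f (x i)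
      + ((t : ℝ) + 1)⁻¹ • ∑ i ∈ Finset.range (t + 1), E i := by
  rw [pathHessian, avgHessian_uniformWeights, Finset.sum_add_distrib, smul_add]

lemma norm_avgNoise (hl : 0 < lmin) (t : ℕ) :
    ‖((t : ℝ) + 1)⁻¹ • ∑ i ∈ Finset.range (t + 1), E i‖ = relNoise E lmin t * lmin := by
  have ht : (0 : ℝ) < (t : ℝ) + 1 := by positivity
  rw [norm_smul, Real.norm_of_nonneg (by positivity), relNoise]
  field_simp

lemma isSelfAdjoint_pathHessian (hf : IsObjective f lmin lmax) (hE : ∀ i, IsSelfAdjoint (E i))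
    (t : ℕ) : IsSelfAdjoint (pathHessian f x E t) := by
  rw [pathHessian_eq]
  exact isSelfAdjoint_add
    (isSelfAdjoint_smul (isSelfAdjoint_sum _ fun i _ => isSelfAdjoint_hess hf.smooth _) _)
    (isSelfAdjoint_smul (isSelfAdjoint_sum _ fun i _ => hE i) _)

/-- The averaged Hessian inherits the spectral bounds of the Hessians up to the averaged noise. -/
lemma pathHessian_bounds (hf : IsObjective f lmin lmax) {t : ℕ} (hε : relNoise E lmin t ≤ ε)
    (v : Vec d) :
    (1 - ε) * lmin * ‖v‖ ^ 2 ≤ inner ℝ v (pathHessian f x E t v) ∧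
      inner ℝ v (pathHessian f x E t v) ≤ (1 + ε) * lmax * ‖v‖ ^ 2 := by
  have hl := hf.pos
  have ht : (0 : ℝ) < (t : ℝ) + 1 := by positivity
  have hε0 : 0 ≤ ε := le_trans (by rw [relNoise]; positivity) hε
  set B := ((t : ℝ) + 1)⁻¹ • ∑ i ∈ Finset.range (t + 1), E i with hB
  have hBv := abs_inner_le_opNorm B v v
  have hBn : ‖B‖ * ‖v‖ * ‖v‖ ≤ ε * lmin * ‖v‖ ^ 2 := by
    rw [hB, norm_avgNoise hl, pow_two, ← mul_assoc]
    gcongr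
  have hmean : inner ℝ v ((((t : ℝ) + 1)⁻¹ • ∑ i ∈ Finset.range (t + 1), hess f (x i)) v)
      = ((t : ℝ) + 1)⁻¹ * ∑ i ∈ Finset.range (t + 1), inner ℝ v (hess f (x i) v) := by
    simp [inner_smul_right, inner_sum]
  have hsplit : inner ℝ v (pathHessian f x E t v)
      = ((t : ℝ) + 1)⁻¹ * ∑ i ∈ Finset.range (t + 1), inner ℝ v (hess f (x i) v)
        + inner ℝ v (B v) := by
    rw [pathHessian_eq, ← hmean, add_apply, inner_add_right]
  have hlow : lmin * ‖v‖ ^ 2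
      ≤ ((t : ℝ) + 1)⁻¹ * ∑ i ∈ Finset.range (t + 1), inner ℝ v (hess f (x i) v) := by
    have := Finset.card_nsmul_le_sum (Finset.range (t + 1))
      (fun i => inner ℝ v (hess f (x i) v)) _ fun i _ => hf.lower (x i) v
    rw [Finset.card_range, nsmul_eq_mul] at this
    push_cast at this
    rw [inv_mul_eq_div, le_div_iff₀ ht, mul_comm]
    exact this
  have hupp : ((t : ℝ) + 1)⁻¹ * ∑ i ∈ Finset.range (t + 1), inner ℝ v (hess f (x i) v)
      ≤ lmax * ‖v‖ ^ 2 := by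
    have := Finset.sum_le_card_nsmul (Finset.range (t + 1))
      (fun i => inner ℝ v (hess f (x i) v)) _ fun i _ => hf.upper (x i) v
    rw [Finset.card_range, nsmul_eq_mul] at this
    push_cast at this
    rw [inv_mul_eq_div, div_le_iff₀ ht, mul_comm (lmax * ‖v‖ ^ 2)]
    exact this
  have hll : ε * lmin * ‖v‖ ^ 2 ≤ ε * lmax * ‖v‖ ^ 2 := by gcongr; exact hf.le
  rw [hsplit]
  constructor
  · linarith [neg_le_of_abs_le hBv]
  · linarith [le_of_abs_le hBv]

/-- The averaged Hessian differs from the Hessian at the minimizer by the average of the Hessian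
errors at the iterates and the averaged noise. -/
lemma norm_pathHessian_sub_le (hf : IsObjective f lmin lmax) {b : ℕ → ℝ} {Hs : Mat d}
    (hb : ∀ i, ‖hess f (x i) - Hs‖ ≤ b i * lmin) (t : ℕ) :
    ‖pathHessian f x E t - Hs‖
      ≤ ((∑ i ∈ Finset.range (t + 1), b i) / (t + 1) + relNoise E lmin t) * lmin := by
  have ht : (0 : ℝ) < (t : ℝ) + 1 := by positivity
  have h1 : pathHessian f x E t - Hs
      = ((t : ℝ) + 1)⁻¹ • ∑ i ∈ Finset.range (t + 1), (hess f (x i) - Hs)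
        + ((t : ℝ) + 1)⁻¹ • ∑ i ∈ Finset.range (t + 1), E i := by
    have h2 : ((t : ℝ) + 1)⁻¹ • ∑ i ∈ Finset.range (t + 1), Hs = Hs := by
      ext v
      simp only [Finset.sum_const, Finset.card_range]
      simp
      field_simp
    rw [pathHessian_eq, Finset.sum_sub_distrib, smul_sub, h2]
    abel
  rw [h1, add_mul]
  refine (norm_add_le _ _).trans (add_le_add ?_ (norm_avgNoise hf.pos t).le)
  rw [norm_smul, Real.norm_of_nonneg (by positivity), inv_mul_eq_div, div_mul_eq_mul_div,
    Finset.sum_mul]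
  gcongr
  exact (norm_sum_le _ _).trans (Finset.sum_le_sum fun i _ => hb i)

lemma linRate_pos {κ : ℝ} (hκ : 1 ≤ κ) (hβ : 0 < β) (hβ' : β < 1 / 2) (hρ : 0 < ρ)
    (hε : 0 < ε) (hε' : ε < 1) : 0 < linRate κ β ρ ε := by
  have h1 : 0 < 1 - β := by linarith
  have h2 : 0 < 1 - ε := by linarith
  rw [linRate]
  positivity

lemma linRate_lt_one {κ : ℝ} (hκ : 1 ≤ κ) (hβ : 0 < β) (hβ' : β < 1 / 2) (hρ : 0 < ρ)
    (hρ' : ρ < 1) (hε : 0 < ε) (hε' : ε < 1) : linRate κ β ρ ε < 1 := by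
  have h2 : 0 < 1 - ε := by linarith
  have h3 : 4 * β * (1 - β) ≤ 1 := by nlinarith [sq_nonneg (2 * β - 1)]
  have h4 : 0 < 4 * β * (1 - β) := by nlinarith
  have h5 : ρ * (4 * β * (1 - β)) ≤ 1 := by nlinarith
  have h6 : 1 ≤ κ ^ 2 := one_le_pow₀ hκ
  rw [linRate, div_lt_one (by positivity)]
  calc 4 * ρ * β * (1 - β) * (1 - ε) = ρ * (4 * β * (1 - β)) * (1 - ε) := by ring
    _ ≤ 1 * (1 - ε) := by gcongr
    _ < 1 * (1 + ε) := by linarith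
    _ ≤ κ ^ 2 * (1 + ε) := by gcongr

/-- Linear convergence of the objective gap. The average at time `t` contains `t + 1` samples, so
that the step from `t` contracts as soon as `T₁ ≤ t + 1`; this absorbs the rounding of the real
number `T₁`. -/
lemma gap_le_of_relNoise_le (hf : IsObjective f lmin lmax) (hxs : ∀ y, f xs ≤ f y)
    (hβ : 0 < β) (hβ' : β < 1 / 2) (hρ : 0 < ρ) (hρ' : ρ < 1) (hε : 0 < ε) (hε' : ε < 1)
    (hE : ∀ i, IsSelfAdjoint (E i))
    (hstep : ∀ t, NewtonStep f β ρ (pathHessian f x E t) (x t) (x (t + 1)))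
    {T₁ : ℝ} (hT₁ : 0 ≤ T₁) (hnoise : ∀ t : ℕ, T₁ ≤ t + 1 → relNoise E lmin t ≤ ε) {t : ℕ}
    (ht : T₁ ≤ t) :
    f (x t) - f xs
      ≤ (f (x 0) - f xs) * (1 - linRate (lmax / lmin) β ρ ε) ^ ((t : ℝ) - T₁) := by
  have hκ : 1 ≤ lmax / lmin := (one_le_div hf.pos).2 hf.le
  set φ := linRate (lmax / lmin) β ρ ε with hφ
  have hφ0 : 0 < φ := linRate_pos hκ hβ hβ' hρ hε hε'
  have hφ1 : φ < 1 := linRate_lt_one hκ hβ hβ' hρ hρ' hε hε'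
  have hb0 : 0 < 1 - φ := by linarith
  have hgap0 : 0 ≤ f (x 0) - f xs := by linarith [hxs (x 0)]
  have main : ∀ t : ℕ, f (x t) - f xs
      ≤ (f (x 0) - f xs) * (1 - φ) ^ (max 0 ((t : ℝ) - T₁)) := by
    intro t
    induction t with
    | zero =>
      have : max 0 (((0 : ℕ) : ℝ) - T₁) = 0 := max_eq_left (by simpa using hT₁)
      rw [this, Real.rpow_zero, mul_one]
    | succ t ih =>
      rcases le_or_gt T₁ ((t : ℝ) + 1) with h | h
      · have hbd := pathHessian_bounds (x := x) hf (hnoise t h)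
        have hdec := (hstep t).gap_le (xs := xs) hf hβ hβ' hρ hρ' hε hε'
          (isSelfAdjoint_pathHessian hf hE t) (fun v => (hbd v).1) fun v => (hbd v).2
        calc f (x (t + 1)) - f xs ≤ (1 - φ) * (f (x t) - f xs) := hdec
          _ ≤ (1 - φ) * ((f (x 0) - f xs) * (1 - φ) ^ (max 0 ((t : ℝ) - T₁))) := by gcongr
          _ = (f (x 0) - f xs) * (1 - φ) ^ (max 0 ((t : ℝ) - T₁) + 1) := by
            rw [Real.rpow_add_one hb0.ne']; ring
          _ ≤ _ := by
            refine mul_le_mul_of_nonneg_left ?_ hgap0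
            refine Real.rpow_le_rpow_of_exponent_ge hb0 (by linarith) ?_
            push_cast
            exact max_le (by positivity) (by linarith [le_max_right 0 ((t : ℝ) - T₁)])
      · have h0 : max 0 (((t + 1 : ℕ) : ℝ) - T₁) = 0 := max_eq_left (by push_cast; linarith)
        have h1 : max 0 ((t : ℝ) - T₁) = 0 := max_eq_left (by linarith)
        rw [h1] at ih
        rw [h0]
        linarith [(hstep t).le hβ hρ]
  have := main t
  rwa [max_eq_right (by linarith)] at this

/-- After `timeTwo` further steps the linear rate has brought the gap down to the scale of the
neighbourhood. -/
lemma gap_small_of_timeTwo_le {κ gap s : ℝ} (hκ : 1 ≤ κ) (hβ : 0 < β) (hβ' : β < 1 / 2)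
    (hρ : 0 < ρ) (hρ' : ρ < 1) (hε : 0 < ε) (hε' : ε < 1) (hν : 0 < ν) (hL : 0 < L)
    (hl : 0 < lmin) (hgap : 0 ≤ gap) (hs : timeTwo κ β ρ ε ν L lmin gap ≤ s) :
    3 * L ^ 2 * (gap * (1 - linRate κ β ρ ε) ^ s) ≤ ν ^ 2 * lmin ^ 3 := by
  set φ := linRate κ β ρ ε with hφ
  have hφ0 : 0 < φ := linRate_pos hκ hβ hβ' hρ hε hε'
  have hφ1 : φ < 1 := linRate_lt_one hκ hβ hβ' hρ hρ' hε hε'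
  have hD : 0 < ν ^ 2 * lmin ^ 3 := by positivity
  rcases eq_or_lt_of_le hgap with h | h
  · rw [← h]; simp only [zero_mul, mul_zero]; exact hD.le
  set Z := 3 * L ^ 2 * gap / (ν ^ 2 * lmin ^ 3) with hZ
  have hZ0 : 0 < Z := by positivity
  have hlog : Real.log Z ≤ φ * s := by
    have h1 : κ ^ 2 * (1 + ε) / (4 * ρ * β * (1 - β) * (1 - ε)) = φ⁻¹ := by
      rw [hφ, linRate, inv_div]
    have h2 : φ⁻¹ * Real.log Z ≤ s := by
      rw [timeTwo, h1] at hs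
      exact (le_max_right _ _).trans hs
    rwa [inv_mul_le_iff₀ hφ0] at h2
  have hpow : (1 - φ) ^ s ≤ Z⁻¹ := by
    have hs0 : 0 ≤ s := (le_max_left _ _).trans hs
    calc (1 - φ) ^ s ≤ Real.exp (-φ) ^ s := by
          refine Real.rpow_le_rpow (by linarith) ?_ hs0
          linarith [Real.add_one_le_exp (-φ)]
      _ = Real.exp (-(φ * s)) := by rw [← Real.exp_mul]; ring_nf
      _ ≤ Real.exp (-Real.log Z) := Real.exp_le_exp.2 (by linarith)
      _ = Z⁻¹ := by rw [Real.exp_neg, Real.exp_log hZ0]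
  calc 3 * L ^ 2 * (gap * (1 - φ) ^ s) ≤ 3 * L ^ 2 * (gap * Z⁻¹) := by gcongr
    _ = ν ^ 2 * lmin ^ 3 := by rw [hZ]; field_simp

/-! ### Superlinear convergence along one sample path -/

/-- The Hessian errors of the iterates before time `T` are bounded by `κ` each. -/
lemma sum_early_le {T κ : ℝ} (hT : 0 ≤ T) (hκ : 0 ≤ κ) (n : ℕ) :
    ∑ i ∈ Finset.range n, (if T ≤ (i : ℝ) then 0 else κ) ≤ (T + 1) * κ := by
  have h : ∑ i ∈ Finset.range n, (if T ≤ (i : ℝ) then 0 else κ) ≤ min (n : ℝ) (T + 1) * κ := by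
    induction n with
    | zero => simpa using mul_nonneg (le_min le_rfl (by linarith : 0 ≤ T + 1)) hκ
    | succ n ih =>
      rw [Finset.sum_range_succ]
      split_ifs with h
      · refine (by linarith : _ ≤ min (n : ℝ) (T + 1) * κ).trans ?_
        gcongr
        simp
      · rw [not_le] at h
        have h1 : min ((n + 1 : ℕ) : ℝ) (T + 1) = n + 1 := by
          push_cast; exact min_eq_left (by linarith)
        have h2 : min (n : ℝ) (T + 1) = n := min_eq_left (by linarith)
        rw [h2] at ih
        rw [h1]
        linarith
  exact h.trans (by gcongr; exact min_le_right _ _)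

lemma sum_late_le {T : ℝ} (hT : 0 < T) {z : ℕ → ℝ} (hν : 0 ≤ ν)
    (hz : ∀ i : ℕ, T ≤ i → z i ≤ ν) (t : ℕ) :
    ∑ i ∈ Finset.range (t + 1), (if T ≤ (i : ℝ) then z i else 0)
      ≤ max 0 ((t : ℝ) + 1 - T) * ν := by
  induction t with
  | zero =>
    simp only [zero_add, Finset.sum_range_one, Nat.cast_zero, not_le.2 hT, if_false]
    exact mul_nonneg (le_max_left _ _) hν
  | succ t ih =>
    rw [Finset.sum_range_succ]
    split_ifs with h
    · have h1 := hz _ h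
      push_cast at h ⊢
      rw [max_eq_right (by linarith)] at ih ⊢
      linarith
    · rw [add_zero]
      refine ih.trans ?_
      gcongr
      simp

section Local

variable {T κ : ℝ}

/-- The hypotheses of the local phase: noise at most `ε` and iterates in the neighbourhood from
time `T` on. -/
structure IsLocalPhase (f : Vec d → ℝ) (lmin lmax L : ℝ) (xs : Vec d) (β ρ ε ν T : ℝ)
    (x : ℕ → Vec d) (E : ℕ → Mat d) : Prop where
  objective : IsObjective f lmin lmax
  minimizer : ∀ y, f xs ≤ f y
  L_pos : 0 < L
  lipschitz : ∀ y z, ‖hess f y - hess f z‖ ≤ L * ‖y - z‖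
  β_pos : 0 < β
  β_lt : β < 1 / 2
  ν_pos : 0 < ν
  tol_le : max ε ν ≤ min (1 / 3 * ((0.5 - β) / (1.5 - β))) (1 / 48)
  four_le : 4 ≤ T
  step : ∀ t, NewtonStep f β ρ (pathHessian f x E t) (x t) (x (t + 1))
  noise_le : ∀ t : ℕ, T ≤ t → relNoise E lmin t ≤ ε
  near : ∀ t : ℕ, T ≤ t → relDist f xs lmin L (x t) ≤ ν

/-- The accumulated relative distances of the iterates from time `T` to time `t`. -/
noncomputable def lateSum (f : Vec d → ℝ) (xs : Vec d) (lmin L T : ℝ) (x : ℕ → Vec d) (t : ℕ) : ℝ :=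
  ∑ i ∈ Finset.range (t + 1), (if T ≤ (i : ℝ) then relDist f xs lmin L (x i) else 0)

/-- The bound of the relative error of the averaged Hessian at time `t`. -/
noncomputable def hessError (f : Vec d → ℝ) (xs : Vec d) (lmin L T κ : ℝ) (x : ℕ → Vec d)
    (E : ℕ → Mat d) (t : ℕ) : ℝ :=
  ((T + 1) * κ + lateSum f xs lmin L T x t) / (t + 1) + relNoise E lmin t

lemma IsLocalPhase.norm_pathHessian_sub_le (h : IsLocalPhase f lmin lmax L xs β ρ ε ν T x E)
    (hκ : κ = lmax / lmin) (t : ℕ) :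
    ‖pathHessian f x E t - hess f xs‖ ≤ hessError f xs lmin L T κ x E t * lmin := by
  have hf := h.objective
  have hl := hf.pos
  have hκ0 : 0 ≤ κ := by rw [hκ]; exact div_nonneg (hl.le.trans hf.le) hl.le
  have hT := h.four_le
  have hb : ∀ i : ℕ, ‖hess f (x i) - hess f xs‖
      ≤ ((if T ≤ (i : ℝ) then 0 else κ)
        + (if T ≤ (i : ℝ) then relDist f xs lmin L (x i) else 0)) * lmin := by
    intro i
    split_ifs
    · rw [zero_add]
      exact (h.lipschitz _ _).trans (hf.norm_le_relDist h.L_pos (x i))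
    · rw [add_zero, hκ, div_mul_cancel₀ _ hl.ne']
      exact hf.norm_hess_sub_le _ _
  refine (HessianAveraging.norm_pathHessian_sub_le (E := E) hf hb t).trans ?_
  rw [hessError, lateSum, Finset.sum_add_distrib]
  gcongr
  exact sum_early_le (by linarith) hκ0 _

/-- Once `T κ / (t + 1)` is small, the relative error of the averaged Hessian is small and the
Newton step contracts. -/
lemma IsLocalPhase.contraction (h : IsLocalPhase f lmin lmax L xs β ρ ε ν T x E)
    (hκ : κ = lmax / lmin) {t : ℕ} (hTt : T ≤ t) (hloc : 4 * (T * κ) ≤ max ε ν * (t + 1)) :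
    wnorm (hess f xs) (x (t + 1) - xs)
        ≤ 1.06 * (hessError f xs lmin L T κ x E t + relDist f xs lmin L (x t))
          * wnorm (hess f xs) (x t - xs) ∧
      hessError f xs lmin L T κ x E t ≤ 2.4 / 48 := by
  have hf := h.objective
  have hl := hf.pos
  have hT := h.four_le
  have hβ := h.β_pos
  have hβ' := h.β_lt
  have hκ1 : 1 ≤ κ := by rw [hκ]; exact (one_le_div hl).2 hf.le
  set a := max ε ν with ha
  have ha48 : a ≤ 1 / 48 := h.tol_le.trans (min_le_right _ _)
  -- this form of the tolerance makes the unit step satisfy the Armijo condition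
  have haβ : a * (3 * (1.5 - β)) ≤ 0.5 - β := by
    have h1 := h.tol_le.trans (min_le_left _ _)
    have h2 : 0 < 1.5 - β := by linarith
    have h3 : 1 / 3 * ((0.5 - β) / (1.5 - β)) = (0.5 - β) / (3 * (1.5 - β)) := by
      field_simp
    rw [h3, le_div_iff₀ (by linarith)] at h1
    exact h1
  have hνa : ν ≤ a := le_max_right _ _
  have hεa : ε ≤ a := le_max_left _ _
  have hn : (0 : ℝ) < (t : ℝ) + 1 := by positivity
  have hz := h.near t hTt
  have hz0 : 0 ≤ relDist f xs lmin L (x t) := relDist_nonneg h.L_pos.le hl _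
  have hlate : lateSum f xs lmin L T x t ≤ (t + 1) * ν := by
    refine (sum_late_le (by linarith) h.ν_pos.le h.near t).trans ?_
    gcongr
    · exact h.ν_pos.le
    · exact max_le hn.le (by linarith)
  have hη : hessError f xs lmin L T κ x E t ≤ 2.3125 * a := by
    have h1 : ((T + 1) * κ + lateSum f xs lmin L T x t) / (t + 1) ≤ 1.3125 * a := by
      rw [div_le_iff₀ hn]
      nlinarith
    have h2 := h.noise_le t hTt
    rw [hessError]
    linarith
  set η := hessError f xs lmin L T κ x E t with hηdef
  have hη48 : η ≤ 2.4 / 48 := by linarith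
  have hη0 : 0 ≤ η := by
    have := (norm_nonneg _).trans (h.norm_pathHessian_sub_le hκ t)
    exact nonneg_of_mul_nonneg_left this hl
  have hcon := (h.step t).local_contraction hf h.minimizer h.L_pos h.lipschitz
    (h.norm_pathHessian_sub_le hκ t) hz (by linarith) (by linarith) (by nlinarith)
  refine ⟨?_, hη48⟩
  have hw := wnorm_nonneg (hess f xs) (x (t + 1) - xs)
  have h3 : 1 ≤ 1.06 * (1 - η) := by linarith
  nlinarith

lemma IsLocalPhase.relDist_succ_le (h : IsLocalPhase f lmin lmax L xs β ρ ε ν T x E)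
    (hκ : κ = lmax / lmin) {t : ℕ} (hTt : T ≤ t) (hloc : 4 * (T * κ) ≤ max ε ν * (t + 1)) :
    relDist f xs lmin L (x (t + 1)) ≤ relDist f xs lmin L (x t) / 10 := by
  obtain ⟨h1, h2⟩ := h.contraction hκ hTt hloc
  have hl := h.objective.pos
  have hL := h.L_pos
  have hs : 0 < lmin * Real.sqrt lmin := mul_pos hl (Real.sqrt_pos.2 hl)
  have hz : relDist f xs lmin L (x t) ≤ 1 / 48 :=
    (h.near t hTt).trans ((le_max_right _ _).trans (h.tol_le.trans (min_le_right _ _)))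
  have hw := wnorm_nonneg (hess f xs) (x t - xs)
  have h3 : wnorm (hess f xs) (x (t + 1) - xs) ≤ wnorm (hess f xs) (x t - xs) / 10 := by
    nlinarith
  calc relDist f xs lmin L (x (t + 1))
      = L * wnorm (hess f xs) (x (t + 1) - xs) / (lmin * Real.sqrt lmin) := rfl
    _ ≤ L * (wnorm (hess f xs) (x t - xs) / 10) / (lmin * Real.sqrt lmin) := by gcongr
    _ = L * wnorm (hess f xs) (x t - xs) / (lmin * Real.sqrt lmin) / 10 := by ring

/-- The accumulated relative distances stay of the order `T κ`: up to time `T + J` because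
`J ν = 4 T κ`, afterwards because the distances decay geometrically. -/
lemma IsLocalPhase.lateSum_le (h : IsLocalPhase f lmin lmax L xs β ρ ε ν T x E)
    (hκ : κ = lmax / lmin) {t : ℕ} (hTt : T ≤ t) :
    lateSum f xs lmin L T x t + relDist f xs lmin L (x t) ≤ 4 * (T * κ) + 3 * ν ∧
      (t + 1) * relDist f xs lmin L (x t) ≤ 4.2 * (T * κ) := by
  have hl := h.objective.pos
  have hT := h.four_le
  have hν := h.ν_pos
  have hκ1 : 1 ≤ κ := by rw [hκ]; exact (one_le_div hl).2 h.objective.le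
  have hTκ : T ≤ T * κ := le_mul_of_one_le_right (by linarith) hκ1
  have hν48 : ν ≤ 1 / 48 := (le_max_right _ _).trans (h.tol_le.trans (min_le_right _ _))
  induction t with
  | zero => simp only [Nat.cast_zero] at hTt; linarith
  | succ t ih =>
    have hz := h.near _ hTt
    -- the two cases are `t < T + J` and `T + J ≤ t`, multiplied by `ν`
    rcases lt_or_ge ((t : ℝ) * ν) (T * ν + 4 * (T * κ)) with hJ | hJ
    · have h1 := sum_late_le (by linarith) hν.le h.near (t + 1)
      push_cast at h1 hTt hz ⊢
      rw [max_eq_right (by linarith)] at h1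
      constructor
      · rw [lateSum]
        nlinarith
      · have h2 : ((t : ℝ) + 1 + 1) * relDist f xs lmin L (x (t + 1)) ≤ (t + 1 + 1) * ν := by
          gcongr
        nlinarith
    · have hTt' : T ≤ t := by
        have h2 : T * ν ≤ t * ν := by nlinarith
        exact le_of_mul_le_mul_right h2 hν
      have hloc : 4 * (T * κ) ≤ max ε ν * ((t : ℝ) + 1) := by
        have h3 : ν * ((t : ℝ) + 1) ≤ max ε ν * ((t : ℝ) + 1) := by
          gcongr; exact le_max_right _ _
        nlinarith
      obtain ⟨h4, h5⟩ := ih hTt'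
      have h6 := h.relDist_succ_le hκ hTt' hloc
      have hz0 : 0 ≤ relDist f xs lmin L (x t) := relDist_nonneg h.L_pos.le hl _
      have h7 : lateSum f xs lmin L T x (t + 1)
          = lateSum f xs lmin L T x t + relDist f xs lmin L (x (t + 1)) := by
        rw [lateSum, Finset.sum_range_succ, if_pos hTt, lateSum]
      have ht0 : (0 : ℝ) ≤ t := Nat.cast_nonneg t
      constructor
      · linarith
      · push_cast
        nlinarith

/-- The superlinear contraction: the factor is of the order `T κ / (t + 1)` plus the averaged
noise. -/
lemma IsLocalPhase.superlinear (h : IsLocalPhase f lmin lmax L xs β ρ ε ν T x E)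
    (hκ : κ = lmax / lmin) {t : ℕ} (hTt : T ≤ t) (hloc : 4 * (T * κ) ≤ max ε ν * (t + 1)) :
    wnorm (hess f xs) (x (t + 1) - xs)
      ≤ (11 * (T * κ / (t + 1)) + 2 * relNoise E lmin t) * wnorm (hess f xs) (x t - xs) := by
  obtain ⟨h1, -⟩ := h.contraction hκ hTt hloc
  obtain ⟨h2, h3⟩ := h.lateSum_le hκ hTt
  have hl := h.objective.pos
  have hT := h.four_le
  have hκ1 : 1 ≤ κ := by rw [hκ]; exact (one_le_div hl).2 h.objective.le
  have hTκ : T ≤ T * κ := le_mul_of_one_le_right (by linarith) hκ1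
  have hν48 : ν ≤ 1 / 48 := (le_max_right _ _).trans (h.tol_le.trans (min_le_right _ _))
  have hn : (0 : ℝ) < (t : ℝ) + 1 := by positivity
  have hz0 : 0 ≤ relDist f xs lmin L (x t) := relDist_nonneg h.L_pos.le hl _
  have he0 : 0 ≤ relNoise E lmin t := by rw [relNoise]; positivity
  refine h1.trans (mul_le_mul_of_nonneg_right ?_ (wnorm_nonneg _ _))
  have h4 : ((T + 1) * κ + lateSum f xs lmin L T x t) / (t + 1) ≤ 5.3 * (T * κ / (t + 1)) := by
    rw [← mul_div_assoc]
    gcongr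
    nlinarith
  have h5 : relDist f xs lmin L (x t) ≤ 4.2 * (T * κ / (t + 1)) := by
    rw [← mul_div_assoc, le_div_iff₀ hn]
    linarith
  have h6 : 0 ≤ T * κ / (t + 1) := by positivity
  rw [hessError]
  linarith

end Local

end Path

/-! ### The iteration counts -/

section Counts

variable {D M : ℝ}

/-- From the iteration count `4 M² log (D M)` on, the logarithmic factor `log (D n)` is at most
`n / M²`. -/
lemma log_le_div_of_count_le (hD : 1 ≤ D) (hM : 1 ≤ M) (hDM : 1 ≤ Real.log (D * M)) {n : ℝ}
    (hn : 4 * M ^ 2 * Real.log (D * M) ≤ n) : Real.log (D * n) ≤ n / M ^ 2 := by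
  set y := Real.log (D * M) with hy
  set T := 4 * M ^ 2 * y with hT
  have hM2 : 1 ≤ M ^ 2 := one_le_pow₀ hM
  have hTpos : 0 < T := by positivity
  have hn0 : 0 < n := hTpos.trans_le hn
  have hDM0 : 0 < D * M := by positivity
  -- the bound holds at `n = T`, and beyond `T` the logarithm grows more slowly than `n / M²`
  have h1 : Real.log (D * T) ≤ 4 * y := by
    have h2 : D * T ≤ Real.exp (4 * y) := by
      have h3 : Real.exp (4 * y) = (D * M) ^ 2 * Real.exp (2 * y) := by
        have h4 : Real.exp y = D * M := Real.exp_log hDM0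
        rw [show 4 * y = y + y + 2 * y by ring, Real.exp_add, Real.exp_add, h4]
        ring
      have h5 : 4 * y ≤ Real.exp (2 * y) := by
        have h6 : Real.exp (2 * y) = Real.exp y ^ 2 := by
          rw [← Real.exp_nat_mul]; norm_num
        have h7 := Real.add_one_le_exp y
        rw [h6]
        nlinarith [sq_nonneg (y - 1)]
      rw [h3, hT]
      calc D * (4 * M ^ 2 * y) = D * M ^ 2 * (4 * y) := by ring
        _ ≤ D ^ 2 * M ^ 2 * Real.exp (2 * y) := by
            gcongr
            nlinarith
        _ = _ := by ring
    calc _ ≤ _ := Real.log_le_log (by positivity) h2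
      _ = _ := Real.log_exp _
  have h8 : Real.log (D * n) = Real.log (D * T) + Real.log (n / T) := by
    rw [← Real.log_mul (by positivity) (by positivity)]
    congr 1
    field_simp
  have h9 : Real.log (n / T) ≤ n / T - 1 := Real.log_le_sub_one_of_pos (by positivity)
  have h10 : 4 * y = T / M ^ 2 := by rw [hT]; field_simp
  have h11 : n / T - 1 ≤ (n - T) / M ^ 2 := by
    have h12 : n / T - 1 = (n - T) / T := by field_simp
    rw [h12]
    have h13 : M ^ 2 ≤ T := by rw [hT]; nlinarith
    have h14 : 0 ≤ n - T := by linarith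
    gcongr
  have h15 : n / M ^ 2 = T / M ^ 2 + (n - T) / M ^ 2 := by ring
  linarith

end Counts

/-! ### The good event -/

/-- A tail exponent of twice the logarithm leaves the summable failure probability `δ / n²`; the
prefactor `2` is absorbed by `exp 1 ≤ d / δ`. -/
lemma two_mul_exp_neg_two_log_le {d δ n : ℝ} (hδ : 0 < δ) (hd : 0 < d)
    (hdδ : Real.exp 1 ≤ d / δ) (hn : 0 < n) {e : ℝ} (he : e ≤ -(2 * Real.log (d / δ * n))) :
    2 * d * Real.exp e ≤ δ * (1 / n ^ 2) := by
  have h2 : 2 * δ ≤ d := by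
    have h1 := Real.add_one_le_exp (1 : ℝ)
    have h3 : 2 ≤ d / δ := by linarith
    rwa [le_div_iff₀ hδ] at h3
  have h4 : Real.exp (-(2 * Real.log (d / δ * n))) = (δ / (d * n)) ^ 2 := by
    have hpos : 0 < d / δ * n := by positivity
    rw [show -(2 * Real.log (d / δ * n)) = -Real.log (d / δ * n) + -Real.log (d / δ * n) by ring,
      Real.exp_add, Real.exp_neg, Real.exp_log hpos]
    field_simp
  calc 2 * d * Real.exp e ≤ 2 * d * (δ / (d * n)) ^ 2 := by
        rw [← h4]; gcongr
    _ = δ * (2 * δ / d) * (1 / n ^ 2) := by field_simp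
    _ ≤ δ * 1 * (1 / n ^ 2) := by
        gcongr
        rwa [div_le_one hd]
    _ = _ := by ring

lemma sq_div_one_sub_cube_le {u : ℝ} (hu2 : u ≤ 1 / 2) :
    u ^ 2 / (1 - u) ^ 3 ≤ 8 * u ^ 2 := by
  have h1 : (1 / 2 : ℝ) ^ 3 ≤ (1 - u) ^ 3 := by gcongr; linarith
  have h2 : (0 : ℝ) < (1 - u) ^ 3 := by linarith
  rw [div_le_iff₀ h2]
  nlinarith [sq_nonneg u]

section Run

variable {d : ℕ} {Ω : Type*} {mΩ : MeasurableSpace Ω} {P : Measure Ω} [IsProbabilityMeasure P]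
  {f : Vec d → ℝ} {noise : Kernel (Vec d) (Mat d)} {W : ℕ → ℝ} {β ρ UE δ : ℝ} {x₀ : Vec d}
  {𝓕 : Filtration ℕ mΩ} {x : ℕ → Ω → Vec d} {E : ℕ → Ω → Mat d}

/-- Concentration of the sum of the first `n` noise matrices, in the sub-Gaussian regime
`log (d n / δ) ≤ n`. -/
lemma IsRun.measure_noiseSum_ge_le (hrun : IsRun P f noise W β ρ x₀ 𝓕 x E)
    (hnoise : IsSubexpNoise noise UE) (hU : 0 < UE) (hd : 0 < d) (hδ : 0 < δ)
    (hdδ : Real.exp 1 ≤ d / δ) {n : ℕ} (hn : 0 < n) (hlog0 : 0 ≤ Real.log (d / δ * n))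
    (hlog : Real.log (d / δ * n) ≤ n) :
    P {ω | 8 * UE * n * Real.sqrt (Real.log (d / δ * n) / n) ≤ ‖noiseSum E n ω‖}
      ≤ ENNReal.ofReal (δ * (1 / (n : ℝ) ^ 2)) := by
  have hn0 : (0 : ℝ) < n := by exact_mod_cast hn
  set r := Real.sqrt (Real.log (d / δ * n) / n) with hr
  have hr0 : 0 ≤ r := Real.sqrt_nonneg _
  have hr2 : n * r ^ 2 = Real.log (d / δ * n) := by
    rw [hr, Real.sq_sqrt (div_nonneg hlog0 hn0.le)]
    field_simp
  have hr1 : r ≤ 1 := by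
    rw [hr, ← Real.sqrt_one]
    exact Real.sqrt_le_sqrt ((div_le_one hn0).2 hlog)
  -- with `u = r / 2` the exponent is at most `-4 n r² + 2 n r² = -2 log (d n / δ)`
  have h := hrun.measure_norm_noiseSum_ge_le hnoise hU hd (u := r / 2) (by linarith)
    (by linarith) (8 * UE * n * r) n
  have hsub : {ω | 8 * UE * n * r ≤ ‖noiseSum E n ω‖}
      ⊆ {ω | ∃ k ≤ n, 8 * UE * n * r ≤ ‖noiseSum E k ω‖} := fun ω hω => ⟨n, le_rfl, hω⟩
  refine (measure_mono hsub).trans (h.trans ?_)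
  refine ENNReal.ofReal_le_ofReal (two_mul_exp_neg_two_log_le hδ (by exact_mod_cast hd) hdδ hn0 ?_)
  have h1 := sq_div_one_sub_cube_le (u := r / 2) (by linarith)
  have h2 : r / 2 * (8 * UE * n * r) / UE = 4 * (n * r ^ 2) := by field_simp; ring
  have h3 : n * ((r / 2) ^ 2 / (1 - r / 2) ^ 3) ≤ n * (8 * (r / 2) ^ 2) := by gcongr
  rw [h2, ← hr2]
  linarith

/-- A uniform bound of all noise sums up to the end of the first superlinear phase. A union bound
over the single times would cost a factor `log (d N / δ)`, which is not controlled by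
`log (d T / δ)` when the noise level `UE` is small; the maximal inequality avoids it. -/
lemma IsRun.measure_exists_noiseSum_ge_le (hrun : IsRun P f noise W β ρ x₀ 𝓕 x E)
    (hnoise : IsSubexpNoise noise UE) (hU : 0 < UE) (hd : 0 < d) (hδ : 0 < δ)
    (hdδ : Real.exp 1 ≤ d / δ) {T R : ℝ} (hT : 1 ≤ T) (hR : 0 < R)
    (hΛ : 1 ≤ Real.log (d / δ * T)) (hRΛ : 8 * Real.log (d / δ * T) ≤ R) {n : ℕ}
    (hn : n ≤ R ^ 2 / (4 * Real.log (d / δ * T)) + 1) :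
    P {ω | ∃ k ≤ n, 40 * R * UE ≤ ‖noiseSum E k ω‖} ≤ ENNReal.ofReal δ := by
  set Λ := Real.log (d / δ * T) with hΛdef
  have hΛ0 : 0 < Λ := by linarith
  -- with `u = Λ / R` the linear term is `40 Λ`, and the quadratic one stays of order `Λ`
  set u := Λ / R with hu
  have hu0 : 0 ≤ u := by positivity
  have hu8 : u ≤ 1 / 8 := by rw [hu, div_le_iff₀ hR]; linarith
  have h := hrun.measure_norm_noiseSum_ge_le hnoise hU hd hu0 (by linarith) (40 * R * UE) n
  refine h.trans (ENNReal.ofReal_le_ofReal ?_)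
  refine (two_mul_exp_neg_two_log_le hδ (by exact_mod_cast hd) hdδ (by linarith : 0 < T)
    (?_ : _ ≤ -(2 * Λ))).trans ?_
  · have h1 := sq_div_one_sub_cube_le (u := u) (by linarith)
    have h2 : u * (40 * R * UE) / UE = 40 * Λ := by rw [hu]; field_simp
    have h3 : (n : ℝ) * (u ^ 2 / (1 - u) ^ 3) ≤ (R ^ 2 / (4 * Λ) + 1) * (8 * u ^ 2) := by
      have h6 : 0 < 1 - u := by linarith
      gcongr
    have h4 : R ^ 2 / (4 * Λ) * (8 * u ^ 2) = 2 * Λ := by rw [hu]; field_simp; norm_num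
    have h5 : u ^ 2 ≤ 1 := by nlinarith
    rw [h2]
    linarith
  · have h6 : 1 / T ^ 2 ≤ 1 := by
      rw [div_le_one (by positivity)]; exact one_le_pow₀ hT
    nlinarith

/-- The union bound. The first term of `∑ δ / n² = δ π² / 6` pays for the maximal inequality. -/
lemma measure_goodEvent_ge (hδ : 0 < δ) {B : ℕ → Set Ω}
    (hB : ∀ n : ℕ, P (B n) ≤ ENNReal.ofReal (δ * (1 / (n : ℝ) ^ 2))) {G : Set Ω}
    (hG : ∀ᵐ ω ∂P, (∀ n, ω ∉ B n) → ω ∈ G) :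
    ENNReal.ofReal (1 - δ * Real.pi ^ 2 / 6) ≤ P G := by
  have hsum := hasSum_zeta_two.mul_left δ
  have hU : P (⋃ n, B n) ≤ ENNReal.ofReal (δ * Real.pi ^ 2 / 6) := by
    calc P (⋃ n, B n) ≤ ∑' n, P (B n) := measure_iUnion_le _
      _ ≤ ∑' n : ℕ, ENNReal.ofReal (δ * (1 / (n : ℝ) ^ 2)) := ENNReal.tsum_le_tsum hB
      _ = ENNReal.ofReal (δ * Real.pi ^ 2 / 6) := by
        rw [← ENNReal.ofReal_tsum_of_nonneg (fun n => by positivity) hsum.summable, hsum.tsum_eq,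
          mul_div_assoc]
  have h1 : (1 : ENNReal) ≤ P G + P (⋃ n, B n) := by
    calc (1 : ENNReal) = P Set.univ := measure_univ.symm
      _ ≤ P (G ∪ ⋃ n, B n) := by
        refine measure_mono_ae ?_
        filter_upwards [hG] with ω hω _
        by_cases h : ∀ n, ω ∉ B n
        · exact Or.inl (hω h)
        · push Not at h
          exact Or.inr (Set.mem_iUnion.2 h)
      _ ≤ _ := measure_union_le _ _
  rw [ENNReal.ofReal_sub _ (by positivity), ENNReal.ofReal_one]
  exact tsub_le_iff_right.2 (h1.trans (by gcongr))

end Run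

/-! ### The convergence phases on the good event -/

section Phases

variable {d : ℕ} {f : Vec d → ℝ} {lmin lmax L UE : ℝ} {xs : Vec d} {β ρ δ ε ν : ℝ}
  {x : ℕ → Vec d} {E : ℕ → Mat d} {κ Υ φ T₁ T J K : ℝ}

lemma one_le_log_mul {D M : ℝ} (hD : Real.exp 1 ≤ D) (hM : 1 ≤ M) : 1 ≤ Real.log (D * M) := by
  have hD0 : 0 < D := (Real.exp_pos 1).trans_le hD
  rw [Real.le_log_iff_exp_le (by positivity)]
  exact hD.trans (le_mul_of_one_le_right hD0.le hM)

lemma one_le_of_exp_one_le {D : ℝ} (hD : Real.exp 1 ≤ D) : 1 ≤ D :=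
  (Real.one_le_exp zero_le_one).trans hD

lemma four_mul_sq_le_timeOne (hdδ : Real.exp 1 ≤ d / δ) :
    4 * max 1 (8 * Υ / ε) ^ 2 ≤ timeOne d Υ ε δ := by
  have h := one_le_log_mul hdδ (le_max_left 1 (8 * Υ / ε))
  rw [timeOne]
  exact le_mul_of_one_le_right (by positivity) h

lemma log_le_of_timeOne_le (hdδ : Real.exp 1 ≤ d / δ) {n : ℝ} (hn : timeOne d Υ ε δ ≤ n) :
    Real.log (d / δ * n) ≤ n / max 1 (8 * Υ / ε) ^ 2 :=
  log_le_div_of_count_le (one_le_of_exp_one_le hdδ) (le_max_left _ _)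
    (one_le_log_mul hdδ (le_max_left _ _)) hn

/-- From `timeOne` on, the concentration bound of the averaged noise is at most `ε`. -/
lemma noise_level_le (hdδ : Real.exp 1 ≤ d / δ) (hΥ : 0 < Υ) (hε : 0 < ε) {n : ℝ}
    (hn : timeOne d Υ ε δ ≤ n) : 8 * Υ * Real.sqrt (Real.log (d / δ * n) / n) ≤ ε := by
  have h1 := log_le_of_timeOne_le hdδ hn
  have h2 := (four_mul_sq_le_timeOne (Υ := Υ) (ε := ε) hdδ).trans hn
  set M := max 1 (8 * Υ / ε) with hM
  have hM1 : 1 ≤ M := le_max_left _ _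
  have hM2 : 8 * Υ / ε ≤ M := le_max_right _ _
  have hn0 : 0 < n := by nlinarith
  have h3 : Real.sqrt (Real.log (d / δ * n) / n) ≤ 1 / M := by
    refine Real.sqrt_le_iff.2 ⟨by positivity, ?_⟩
    rw [div_le_iff₀ hn0]
    refine h1.trans (le_of_eq ?_)
    field_simp
  calc 8 * Υ * Real.sqrt (Real.log (d / δ * n) / n) ≤ 8 * Υ * (1 / M) := by gcongr
    _ ≤ ε := by
      rw [mul_one_div, div_le_iff₀ (by positivity)]
      rw [div_le_iff₀ hε] at hM2
      linarith

/-- Deterministic form of the convergence theorem, on a sample path whose noise sums satisfy the two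
concentration bounds. -/
lemma convergence_of_noise_bounds (hf : IsObjective f lmin lmax) (hxs : ∀ y, f xs ≤ f y)
    (hL : 0 < L) (hLip : ∀ y z, ‖hess f y - hess f z‖ ≤ L * ‖y - z‖) (hUE : 0 < UE)
    (hβ : 0 < β) (hβ' : β < 1 / 2) (hρ : 0 < ρ) (hρ' : ρ < 1) (hdδ : Real.exp 1 ≤ d / δ)
    (hε : 0 < ε) (hε' : ε < 1) (hν : 0 < ν)
    (hεν : max ε ν ≤ min (1 / 3 * ((0.5 - β) / (1.5 - β))) (1 / 48))
    (hE : ∀ i, IsSelfAdjoint (E i))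
    (hstep : ∀ t, NewtonStep f β ρ (pathHessian f x E t) (x t) (x (t + 1)))
    (hκ : κ = lmax / lmin) (hΥ : Υ = UE / lmin) (hφ : φ = linRate κ β ρ ε)
    (hT₁ : T₁ = timeOne d Υ ε δ)
    (hT : T = T₁ + timeTwo κ β ρ ε ν L lmin (f (x 0) - f xs))
    (hJ : J = 4 * T * κ / ν)
    (hK : K = T ^ 2 * κ ^ 2 / (4 * Υ ^ 2 * Real.log (d * T / δ)) - T - J)
    (hconc : ∀ n : ℕ, 2 ≤ n → Real.log (d / δ * n) ≤ n →
      ‖∑ i ∈ Finset.range n, E i‖ ≤ 8 * UE * n * Real.sqrt (Real.log (d / δ * n) / n))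
    (hmax : ∀ n : ℕ, (n : ℝ) ≤ (T * κ / Υ) ^ 2 / (4 * Real.log (d / δ * T)) + 1 →
      ‖∑ i ∈ Finset.range n, E i‖ ≤ 40 * (T * κ / Υ) * UE) :
    (∀ t : ℕ, T ≤ t → x t ∈ nbhd (hess f xs) xs lmin L ν) ∧
    (∀ t : ℕ, T₁ ≤ t →
      ‖x t - xs‖ ≤ Real.sqrt (2 / lmin * (f (x 0) - f xs) * (1 - φ) ^ ((t : ℝ) - T₁)) ∧
      wnorm (hess f xs) (x t - xs) ≤
        Real.sqrt (2 * κ * (f (x 0) - f xs) * (1 - φ) ^ ((t : ℝ) - T₁))) ∧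
    (∀ t : ℕ, 0 ≤ (t : ℝ) - T - J → (t : ℝ) - T - J ≤ K →
      wnorm (hess f xs) (x (t + 1) - xs) ≤
        12 * rateOne T κ t * wnorm (hess f xs) (x t - xs)) ∧
    (∀ t : ℕ, T + J + K ≤ t →
      wnorm (hess f xs) (x (t + 1) - xs) ≤
        12 * rateTwo d Υ δ t * wnorm (hess f xs) (x t - xs)) := by
  have hl := hf.pos
  have hΥ0 : 0 < Υ := by rw [hΥ]; positivity
  have hκ1 : 1 ≤ κ := by rw [hκ]; exact (one_le_div hl).2 hf.le
  have hD0 : 0 < (d : ℝ) / δ := (Real.exp_pos 1).trans_le hdδ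
  have hgap0 : 0 ≤ f (x 0) - f xs := by linarith [hxs (x 0)]
  have hM := four_mul_sq_le_timeOne (Υ := Υ) (ε := ε) hdδ
  have hM1 : 1 ≤ max 1 (8 * Υ / ε) := le_max_left _ _
  have hM2 : 1 ≤ max 1 (8 * Υ / ε) ^ 2 := one_le_pow₀ hM1
  have hT₁4 : 4 ≤ T₁ := by rw [hT₁]; linarith
  have hT₁T : T₁ ≤ T := by
    have h0 : 0 ≤ timeTwo κ β ρ ε ν L lmin (f (x 0) - f xs) := le_max_left _ _
    linarith
  -- the averaged noise
  have hnoise : ∀ t : ℕ, T₁ ≤ t + 1 → relNoise E lmin t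
      ≤ 8 * Υ * Real.sqrt (Real.log (d / δ * (t + 1)) / (t + 1)) := by
    intro t ht
    have ht2 : 2 ≤ t + 1 := by
      have : (2 : ℝ) ≤ ((t + 1 : ℕ) : ℝ) := by push_cast; linarith
      exact_mod_cast this
    have hlog : Real.log (d / δ * ((t + 1 : ℕ) : ℝ)) ≤ ((t + 1 : ℕ) : ℝ) := by
      push_cast
      refine (log_le_of_timeOne_le (Υ := Υ) (ε := ε) hdδ (by rw [← hT₁]; exact ht)).trans ?_
      exact div_le_self (by positivity) hM2
    have h := hconc (t + 1) ht2 hlog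
    push_cast at h
    rw [relNoise, div_le_iff₀ (by positivity)]
    refine h.trans (le_of_eq ?_)
    rw [hΥ]
    field_simp
  have hnoiseε : ∀ t : ℕ, T₁ ≤ t + 1 → relNoise E lmin t ≤ ε := fun t ht =>
    (hnoise t ht).trans (noise_level_le hdδ hΥ0 hε (by rw [← hT₁]; exact ht))
  -- linear convergence
  have hgap : ∀ t : ℕ, T₁ ≤ t →
      f (x t) - f xs ≤ (f (x 0) - f xs) * (1 - φ) ^ ((t : ℝ) - T₁) := by
    intro t ht
    rw [hφ, hκ]
    exact gap_le_of_relNoise_le hf hxs hβ hβ' hρ hρ' hε hε' hE hstep (by linarith) hnoiseε ht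
  have hnear : ∀ t : ℕ, T ≤ t → relDist f xs lmin L (x t) ≤ ν := by
    intro t ht
    refine hf.relDist_le_of_gap hxs hL hLip hν
      ((le_max_right _ _).trans (hεν.trans (min_le_right _ _))) ?_
    have h1 := gap_small_of_timeTwo_le (s := (t : ℝ) - T₁) hκ1 hβ hβ' hρ hρ' hε hε' hν hL hl hgap0
      (by linarith)
    rw [← hφ] at h1
    exact (mul_le_mul_of_nonneg_left (hgap t (hT₁T.trans ht)) (by positivity)).trans h1
  have hloc : IsLocalPhase f lmin lmax L xs β ρ ε ν T x E :=
    ⟨hf, hxs, hL, hLip, hβ, hβ', hν, hεν, hT₁4.trans hT₁T, hstep,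
      fun t ht => hnoiseε t (by linarith), hnear⟩
  -- the end `N = T + J + K` of the first superlinear phase
  set Λ := Real.log (d / δ * T) with hΛ
  have hT1 : 1 ≤ T := by linarith
  have hΛ1 : 1 ≤ Λ := one_le_log_mul hdδ hT1
  have hΛ0 : 0 < Λ := by linarith
  have hΛT : 64 * Υ ^ 2 * Λ ≤ ε ^ 2 * T := by
    have h1 := log_le_of_timeOne_le (Υ := Υ) (ε := ε) hdδ (hT₁.symm.trans_le hT₁T)
    rw [← hΛ, le_div_iff₀ (by positivity)] at h1
    have h2 : (8 * Υ / ε) ^ 2 ≤ max 1 (8 * Υ / ε) ^ 2 := by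
      gcongr; exact le_max_right _ _
    have h3 : Λ * (8 * Υ / ε) ^ 2 ≤ T := le_trans (by gcongr) h1
    have h4 : ε ^ 2 * (Λ * (8 * Υ / ε) ^ 2) = 64 * Υ ^ 2 * Λ := by field_simp; norm_num
    rw [← h4]
    gcongr
  have hN : T + J + K = (T * κ) ^ 2 / (4 * Υ ^ 2 * Λ) := by
    rw [hK, mul_div_right_comm (d : ℝ) T δ, ← hΛ, mul_pow]; ring
  have hJν : J * ν = 4 * (T * κ) := by rw [hJ]; field_simp
  refine ⟨fun t ht => (mem_nbhd_iff hL hl ν _).2 (hnear t ht), fun t ht => ?_,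
    fun t ht ht' => ?_, fun t ht => ?_⟩
  · have h1 := hf.sq_norm_le_gap hxs (x t)
    have h2 := hgap t ht
    have h3 : ‖x t - xs‖ ^ 2 ≤ 2 / lmin * (f (x 0) - f xs) * (1 - φ) ^ ((t : ℝ) - T₁) := by
      have h4 := mul_le_mul_of_nonneg_left (h1.trans h2) (by positivity : 0 ≤ 2 / lmin)
      refine le_trans (le_of_eq ?_) (h4.trans (le_of_eq ?_))
      · field_simp
      · ring
    refine ⟨Real.le_sqrt_of_sq_le h3, Real.le_sqrt_of_sq_le ?_⟩
    rw [hf.wnorm_sq]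
    refine (hf.upper xs _).trans ?_
    have h5 := mul_le_mul_of_nonneg_left h3 (hl.le.trans hf.le)
    refine h5.trans (le_of_eq ?_)
    rw [hκ]
    ring
  · have hJ0 : 0 ≤ J := by rw [hJ]; positivity
    have hTt : T ≤ t := by linarith
    have hsmall : 4 * (T * κ) ≤ max ε ν * ((t : ℝ) + 1) := by
      calc 4 * (T * κ) = ν * J := by rw [← hJν]; ring
        _ ≤ max ε ν * ((t : ℝ) + 1) := by
          gcongr
          · exact le_max_right _ _
          · linarith
    refine (hloc.superlinear hκ hTt hsmall).trans
      (mul_le_mul_of_nonneg_right ?_ (wnorm_nonneg _ _))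
    have h1 : relNoise E lmin t ≤ 40 * (T * κ / (t + 1)) := by
      have h2 := hmax (t + 1) (by
        have h3 : (T * κ / Υ) ^ 2 / (4 * Λ) = T + J + K := by rw [hN]; field_simp
        rw [h3]
        push_cast
        linarith)
      rw [relNoise, div_le_iff₀ (by positivity)]
      refine h2.trans (le_of_eq ?_)
      rw [hΥ]
      field_simp
    have h4 : 0 ≤ T * κ / (t + 1) := by positivity
    have h5 : rateOne T κ t = 8 * (T * κ / (t + 1)) := by rw [rateOne]; ring
    rw [h5]
    linarith
  · rw [hN] at ht
    have hκ0 : 0 < κ := by linarith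
    have hTκ : T ≤ T * κ := le_mul_of_one_le_right (by linarith) hκ1
    have hN2 : (T * κ) ^ 2 ≤ (t : ℝ) * (4 * Υ ^ 2 * Λ) := by
      rwa [div_le_iff₀ (by positivity)] at ht
    -- `N ≥ 16 T κ² / ε²`
    have hN3 : 16 * (T * κ) * κ ≤ ε ^ 2 * t := by
      have h1 : (T * κ) ^ 2 * 16 ≤ t * (ε ^ 2 * T) := by
        calc (T * κ) ^ 2 * 16 ≤ (t * (4 * Υ ^ 2 * Λ)) * 16 := by gcongr
          _ = t * (64 * Υ ^ 2 * Λ) := by ring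
          _ ≤ t * (ε ^ 2 * T) := by gcongr
      have h2 : T * (16 * (T * κ) * κ) ≤ T * (ε ^ 2 * t) := by
        refine le_trans (le_of_eq ?_) (h1.trans (le_of_eq ?_)) <;> ring
      exact le_of_mul_le_mul_left h2 (by linarith)
    have hN4 : 16 * (T * κ) ≤ ε * t := by
      have h1 : 16 * (T * κ) ≤ 16 * (T * κ) * κ :=
        le_mul_of_one_le_right (by positivity) hκ1
      have h2 : ε ^ 2 * t ≤ ε * t := by
        gcongr
        nlinarith
      linarith
    have ht0 : (0 : ℝ) ≤ t := Nat.cast_nonneg t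
    have hεt : ε * t ≤ t := mul_le_of_le_one_left ht0 hε'.le
    have hTt : T ≤ t := by linarith
    have hsmall : 4 * (T * κ) ≤ max ε ν * ((t : ℝ) + 1) := by
      calc 4 * (T * κ) ≤ ε * t := by linarith
        _ ≤ max ε ν * ((t : ℝ) + 1) := by
          gcongr
          · exact le_max_left _ _
          · linarith
    refine (hloc.superlinear hκ hTt hsmall).trans
      (mul_le_mul_of_nonneg_right ?_ (wnorm_nonneg _ _))
    have h1 := hnoise t (by linarith)
    have hrate : rateTwo d Υ δ t
        = 16 * (Υ * Real.sqrt (Real.log (d / δ * (t + 1)) / (t + 1))) := by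
      rw [rateTwo, mul_div_right_comm (d : ℝ) _ δ]; ring
    set s := Real.sqrt (Real.log (d / δ * (t + 1)) / (t + 1)) with hs
    have hΛt : Λ ≤ Real.log (d / δ * (t + 1)) := by
      refine Real.log_le_log (by positivity) ?_
      gcongr
      linarith
    have hlead : T * κ / (t + 1) ≤ 2 * (Υ * s) := by
      have hs2 : s ^ 2 = Real.log (d / δ * (t + 1)) / (t + 1) :=
        Real.sq_sqrt (div_nonneg (hΛ0.le.trans hΛt) (by positivity))
      have hs0 : 0 ≤ s := Real.sqrt_nonneg _
      refine le_of_sq_le_sq ?_ (by positivity)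
      rw [mul_pow, mul_pow, hs2, div_pow, div_le_iff₀ (by positivity)]
      calc (T * κ) ^ 2 ≤ (t : ℝ) * (4 * Υ ^ 2 * Λ) := hN2
        _ ≤ ((t : ℝ) + 1) * (4 * Υ ^ 2 * Real.log (d / δ * (t + 1))) := by
          gcongr
          linarith
        _ = _ := by field_simp; ring
    have hΥs : 0 ≤ Υ * s := mul_nonneg hΥ0.le (Real.sqrt_nonneg _)
    rw [hrate]
    linarith

end Phases

end HessianAveraging

theorem mainTheorem2 {d : ℕ} {f : HessianAveraging.Vec d → ℝ} {lmin lmax L UE : ℝ}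
    (hf : HessianAveraging.IsObjective f lmin lmax)
    -- the minimizer
    (xs : HessianAveraging.Vec d) (hxs : ∀ y, f xs ≤ f y)
    -- Lipschitz Hessian
    (hL : 0 < L)
    (hLip : ∀ y z, ‖HessianAveraging.hess f y - HessianAveraging.hess f z‖ ≤ L * ‖y - z‖)
    -- sub-exponential oracle noise
    (noise : ProbabilityTheory.Kernel (HessianAveraging.Vec d) (HessianAveraging.Mat d))
    (hUE : 0 < UE) (hnoise : HessianAveraging.IsSubexpNoise noise UE)
    -- parameters
    (β ρ δ ε ν : ℝ) (hβ : 0 < β) (hβ' : β < 1 / 2) (hρ : 0 < ρ) (hρ' : ρ < 1)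
    (hδ : 0 < δ) (hδ' : δ < 1) (hdδ : Real.exp 1 ≤ d / δ)
    (hε : 0 < ε) (hε' : ε < 1) (hν : 0 < ν) (hν' : ν < 1)
    (hεν : max ε ν ≤ min (1 / 3 * ((0.5 - β) / (1.5 - β))) (1 / 48))
    -- a run of the algorithm with uniform averaging
    {Ω : Type*} {mΩ : MeasurableSpace Ω} (P : MeasureTheory.Measure Ω)
    [MeasureTheory.IsProbabilityMeasure P] (𝓕 : MeasureTheory.Filtration ℕ mΩ)
    (x₀ : HessianAveraging.Vec d)
    (x : ℕ → Ω → HessianAveraging.Vec d) (E : ℕ → Ω → HessianAveraging.Mat d)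
    (hrun : HessianAveraging.IsRun P f noise HessianAveraging.uniformWeights β ρ x₀ 𝓕 x E)
    -- the quantities in the conclusion
    (κ Υ φ T₁ T J K : ℝ) (Hs : HessianAveraging.Mat d)
    (hκ : κ = lmax / lmin) (hΥ : Υ = UE / lmin)
    (hφ : φ = HessianAveraging.linRate κ β ρ ε)
    (hT₁ : T₁ = HessianAveraging.timeOne d Υ ε δ)
    (hT : T = T₁ + HessianAveraging.timeTwo κ β ρ ε ν L lmin (f x₀ - f xs))
    (hJ : J = 4 * T * κ / ν)
    (hK : K = T ^ 2 * κ ^ 2 / (4 * Υ ^ 2 * Real.log (d * T / δ)) - T - J)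
    (hHs : Hs = HessianAveraging.hess f xs) :
    ENNReal.ofReal (1 - δ * Real.pi ^ 2 / 6) ≤ P {ω |
      -- the neighbourhood is reached at time `T`, and not left up to `T + J` or later
      (∀ t : ℕ, T ≤ t → x t ω ∈ HessianAveraging.nbhd Hs xs lmin L ν) ∧
      -- linear convergence from time `T₁`
      (∀ t : ℕ, T₁ ≤ t →
        ‖x t ω - xs‖ ≤
          Real.sqrt (2 / lmin * (f x₀ - f xs) * (1 - φ) ^ ((t : ℝ) - T₁)) ∧
        HessianAveraging.wnorm Hs (x t ω - xs) ≤
          Real.sqrt (2 * κ * (f x₀ - f xs) * (1 - φ) ^ ((t : ℝ) - T₁))) ∧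
      -- first superlinear phase
      (∀ t : ℕ, 0 ≤ (t : ℝ) - T - J → (t : ℝ) - T - J ≤ K →
        HessianAveraging.wnorm Hs (x (t + 1) ω - xs) ≤
          12 * HessianAveraging.rateOne T κ t * HessianAveraging.wnorm Hs (x t ω - xs)) ∧
      -- final superlinear phase
      (∀ t : ℕ, T + J + K ≤ t →
        HessianAveraging.wnorm Hs (x (t + 1) ω - xs) ≤
          12 * HessianAveraging.rateTwo d Υ δ t * HessianAveraging.wnorm Hs (x t ω - xs))} := by
  have hl := hf.pos
  have hκ1 : 1 ≤ κ := by rw [hκ]; exact (one_le_div hl).2 hf.le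
  have hΥ0 : 0 < Υ := by rw [hΥ]; positivity
  have hD0 : 0 < (d : ℝ) / δ := (Real.exp_pos 1).trans_le hdδ
  have hd : 0 < d := by
    rcases Nat.eq_zero_or_pos d with h | h
    · rw [h] at hD0; simp at hD0
    · exact h
  have hM := HessianAveraging.four_mul_sq_le_timeOne (Υ := Υ) (ε := ε) hdδ
  have hMmax : 8 * Υ / ε ≤ max 1 (8 * Υ / ε) := le_max_right _ _
  have hM1 : 1 ≤ max 1 (8 * Υ / ε) := le_max_left _ _
  have hM2 : max 1 (8 * Υ / ε) ≤ max 1 (8 * Υ / ε) ^ 2 := le_self_pow₀ hM1 (by norm_num)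
  have hT₁T : T₁ ≤ T := by
    have h0 : 0 ≤ HessianAveraging.timeTwo κ β ρ ε ν L lmin (f x₀ - f xs) := le_max_left _ _
    linarith
  have hT1 : 1 ≤ T := by linarith
  set R := T * κ / Υ with hR
  have hR0 : 0 < R := by positivity
  have hΛ1 := HessianAveraging.one_le_log_mul hdδ hT1
  have hRΛ : 8 * Real.log (d / δ * T) ≤ R := by
    have h1 := HessianAveraging.log_le_of_timeOne_le (Υ := Υ) (ε := ε) hdδ
      (hT₁.symm.trans_le hT₁T)
    rw [le_div_iff₀ (by positivity)] at h1
    have h2 : Real.log (d / δ * T) * (8 * Υ / ε) ≤ T :=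
      le_trans (by gcongr; exact hMmax.trans hM2) h1
    have h3 : 8 * Υ ≤ 8 * Υ / ε := by rw [le_div_iff₀ hε]; nlinarith
    rw [hR, le_div_iff₀ hΥ0]
    calc 8 * Real.log (d / δ * T) * Υ = Real.log (d / δ * T) * (8 * Υ) := by ring
      _ ≤ Real.log (d / δ * T) * (8 * Υ / ε) := by gcongr
      _ ≤ T := h2
      _ ≤ T * κ := le_mul_of_one_le_right (by linarith) hκ1
  set N := R ^ 2 / (4 * Real.log (d / δ * T)) with hN
  -- the bad events; the index `1` carries the maximal inequality
  let B : ℕ → Set Ω := fun n =>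
    if n = 1 then {ω | ∃ k ≤ ⌊N + 1⌋₊, 40 * R * UE ≤ ‖HessianAveraging.noiseSum E k ω‖}
    else if 2 ≤ n ∧ Real.log (d / δ * n) ≤ n then
      {ω | 8 * UE * n * Real.sqrt (Real.log (d / δ * n) / n) ≤ ‖HessianAveraging.noiseSum E n ω‖}
    else ∅
  have hB : ∀ n : ℕ, P (B n) ≤ ENNReal.ofReal (δ * (1 / (n : ℝ) ^ 2)) := by
    intro n
    simp only [B]
    split_ifs with h1 h2
    · rw [h1, Nat.cast_one, one_pow, div_one, mul_one]
      exact hrun.measure_exists_noiseSum_ge_le hnoise hUE hd hδ hdδ hT1 hR0 hΛ1 hRΛ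
        (Nat.floor_le (by positivity))
    · have hn1 : (1 : ℝ) ≤ n := by exact_mod_cast (by omega : 1 ≤ n)
      exact hrun.measure_noiseSum_ge_le hnoise hUE hd hδ hdδ (by omega)
        (zero_le_one.trans (HessianAveraging.one_le_log_mul hdδ hn1)) h2.2
    · simp
  refine HessianAveraging.measure_goodEvent_ge hδ hB ?_
  filter_upwards [hrun.ae_isSelfAdjoint hnoise, hrun.step] with ω hE hstep hgood
  rw [hHs, ← hrun.init ω]
  refine HessianAveraging.convergence_of_noise_bounds (x := fun t => x t ω) (E := fun t => E t ω)
    hf hxs hL hLip hUE hβ hβ' hρ hρ' hdδ hε hε' hν hεν hE hstep hκ hΥ hφ hT₁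
    (by rw [hrun.init ω]; exact hT) hJ hK ?_ ?_
  · intro n hn hlog
    have h := hgood n
    simp only [B, if_neg (show n ≠ 1 by omega), if_pos (show 2 ≤ n ∧ _ from ⟨hn, hlog⟩),
      Set.mem_ofPred_eq, not_le] at h
    exact h.le
  · intro n hn
    have h := hgood 1
    simp only [B, if_pos, Set.mem_ofPred_eq] at h
    push Not at h
    exact (h n (Nat.le_floor hn)).le
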